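/- Let $\Delta$ be the simplex category. Let $\Sigma$ be the category obtained from $\Delta\times\Delta$ by adding a new terminal object $[-1]$, and let $p\colon\Sigma\to\Delta$ be the functor extending the ordinal sum, with $p(q,r)=[q+1+r]$ and $p([-1])=[0]$. Precomposition with $p$ is a functor $p^*\colon \mathrm{sSet}=\mathrm{Fun}(\Delta^{\mathrm{op}},\mathrm{Set})\to \mathrm{Fun}(\Sigma^{\mathrm{op}},\mathrm{Set})$; its right adjoint $p_*$ is right Kan extension along $p$. A simplicial set $X$ is *2-Segal* if for every $n\ge 3$ and every triangulation $T$ of the convex $(n+1)$-gon with vertices $0,\dots,n$ the map from $X_n$ to the limit $X_2\times_{X_1}\cdots\times_{X_1}X_2$ over the triangles and segments of $T$ is a bijection. It is *unital* if moreover for all $n\ge 2$ and $0\le i\le n-1$ the square formed by $s_i\colon X_{n-1}\to X_n$, $s_0\colon X_0\to X_1$, the map $X_{n-1}\to X_0$ induced by $0\mapsto i$ and the map $X_n\to X_1$ induced by $0<1\mapsto i<i+1$ is a pullback. Let $\mathrm{U2Seg}\subset\mathrm{sSet}$ be the full subcategory of unital 2-Segal sets, with inclusion $\iota$. A (small, strict)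 double category $\mathcal D$ is *stable* if the maps $Sq\,\mathcal D\to Hor\,\mathcal D\times_{Ob\,\mathcal D}Ver\,\mathcal D$, sending a square to its (top, left) sides, and $Sq\,\mathcal D\to Ver\,\mathcal D\times_{Ob\,\mathcal D}Hor\,\mathcal D$, sending a square to its (right, bottom) sides, are bijections (fiber products over the sources, respectively over the targets). It is *augmented* by a subset $A\mathcal D\subset Ob\,\mathcal D$ if every object is the target of a unique horizontal morphism with source in $A\mathcal D$ and the source of a unique vertical morphism with target in $A\mathcal D$. Let $\mathrm{DCat}$ be the category of augmented stable double categories and of double functors that preserve the augmentation sets. For $n\ge0$ let $\mathcal W_n\in\mathrm{DCat}$ be the double category with objects $(i,j)$, $0\le i\le j\le n$, horizontal morphisms $(i,j,\ell)\colon(i,j)\to(i,\ell)$, $i\le j\le \ell$, vertical morphisms $(i,k,j)\colon(i,j)\to(k,j)$, $i\le k\le j$, squares $(i,k,j,\ell)$, $i\le k\le j\le\ell$, with corners $(i,j),(i,\ell),(k,j),(k,\ell)$, and augmentation $\{(i,i)\}$. Define: * the path construction $\mathcal P\colon\mathrm{U2Seg}\to\mathrm{DCat}$: $Ob\,(\mathcal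 PX)=X_1$, $Hor\,(\mathcal PX)=Ver\,(\mathcal PX)=X_2$, $Sq\,(\mathcal PX)=X_3$, and $A(\mathcal PX)=X_0$, regarded as a subset of $X_1$ via $s_0$. The source, target and identity maps are $d_2,d_1,s_1$ for horizontal morphisms, $d_1,d_0,s_0$ for vertical morphisms, $d_3,d_2,s_2$ for squares as horizontal morphisms between vertical ones, and $d_1,d_0,s_0$ for squares as vertical morphisms between horizontal ones. The compositions are induced by the inverses of 2-Segal maps; * the Waldhausen construction $S_\bullet\mathcal D=\mathrm{Hom}_{\mathrm{DCat}}(\mathcal W_\bullet,\mathcal D)$, a simplicial set functorial in $\mathcal D\in\mathrm{DCat}$; * the augmented double nerve $N^a\colon\mathrm{DCat}\to\mathrm{Fun}(\Sigma^{\mathrm{op}},\mathrm{Set})$, $N^a\mathcal D=\mathrm{Hom}_{\mathrm{DCat}}(\mathcal W_{p(-)},\mathcal D)$. **Proposition.** The simplicial set $S_\bullet\mathcal D$ is unital 2-Segal for every $\mathcal D\in\mathrm{DCat}$, so that $S_\bullet$ is a functor $\mathrm{DCat}\to\mathrm{U2Seg}$, and there are natural isomorphisms of functors $$N^a\circ\mathcal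 P\;\cong\;p^*\circ\iota\colon\ \mathrm{U2Seg}\to\mathrm{Fun}(\Sigma^{\mathrm{op}},\mathrm{Set}),\qquad \iota\circ S_\bullet\;\cong\;p_*\circ N^a\colon\ \mathrm{DCat}\to\mathrm{sSet}.$$ -/

import Mathlib

open CategoryTheory Opposite Simplicial

universe u v w

namespace Waldhausen

/-- A triangulation of the convex polygon with vertices `0, …, n` in cyclic order, given by the
relation `E i j`: "`i < j` and the segment `ij` is a side or a diagonal of the triangulation".
It is a maximal set of pairwise non-crossing segments between vertices (so it contains every side);
the segments `ij` and `kl` cross if and only if `i < k < j < l` or `k < i < l < j`. -/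
structure IsPolygonTriangulation {n : ℕ} (E : Fin (n + 1) → Fin (n + 1) → Prop) : Prop where
  lt : ∀ i j, E i j → i < j
  noncrossing : ∀ i j k l, E i j → E k l → ¬ (i < k ∧ k < j ∧ j < l)
  maximal : ∀ i j, i < j →
    (∀ k l, E k l → ¬ (i < k ∧ k < j ∧ j < l) ∧ ¬ (k < i ∧ i < l ∧ l < j)) → E i j

/-- The triangles of the triangulation `E`: triples of vertices `t 0 < t 1 < t 2` all of whose edges
belong to `E`. A triple is recorded as the corresponding map `[2] → [n]` in the simplex category. -/
def PolygonTriangle {n : ℕ} (E : Fin (n + 1) → Fin (n + 1) → Prop) : Type :=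
  {t : ⦋2⦌ ⟶ ⦋n⦌ // E (t 0) (t 1) ∧ E (t 1) (t 2) ∧ E (t 0) (t 2)}

/-- The limit of `X₂` over the triangles and `X₁` over the segments of the triangulation, ordered by
inclusion, i.e. the iterated fiber product `X₂ ×_{X₁} ⋯ ×_{X₁} X₂`: families of 2-simplices, one for
each triangle, whose restrictions to any common edge of two triangles agree. -/
def SegalLimit (X : SSet.{u}) {n : ℕ} (E : Fin (n + 1) → Fin (n + 1) → Prop) : Type u :=
  {x : PolygonTriangle E → X _⦋2⦌ //
    ∀ (t t' : PolygonTriangle E) (i j : Fin 3),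
      SimplexCategory.δ i ≫ t.1 = SimplexCategory.δ j ≫ t'.1 → X.δ i (x t) = X.δ j (x t')}

/-- The Segal map of a simplicial set `X` attached to a triangulation. -/
def segalMap (X : SSet.{u}) {n : ℕ} (E : Fin (n + 1) → Fin (n + 1) → Prop) (y : X _⦋n⦌) :
    SegalLimit X E :=
  ⟨fun t => X.map t.1.op y, by
    intro t t' i j h
    have := congrArg (fun f => X.map f.op y) h
    simpa [SimplicialObject.δ] using this⟩

/-- 2-Segal sets: for `n ≥ 3` the Segal map of every triangulation of the `(n + 1)`-gon is a bijection
(a weak equivalence for the trivial model structure on sets, where homotopy limits are limits). -/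
def IsTwoSegal (X : SSet.{u}) : Prop :=
  ∀ (n : ℕ), 3 ≤ n → ∀ E : Fin (n + 1) → Fin (n + 1) → Prop,
    IsPolygonTriangulation E → Function.Bijective (segalMap X E)

/-- Unital 2-Segal sets. In the field `unital` the square is the one with corners
`X_{N-1} → X₀` (restriction to the vertex `i`), `X_N → X₁` (restriction to the edge `i < i + 1`),
`s_i : X_{N-1} → X_N` and `s₀ : X₀ → X₁`, for all `N ≥ 2` (here `N = n + 2`) and `0 ≤ i ≤ N - 1`. -/
structure IsUnitalTwoSegal (X : SSet.{u}) : Prop where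
  twoSegal : IsTwoSegal X
  unital : ∀ (n : ℕ) (i : Fin (n + 2)),
    IsPullback (X.map (SimplexCategory.const ⦋0⦌ ⦋n + 1⦌ i).op) (X.σ i) (X.σ (0 : Fin 1))
      (X.map (SimplexCategory.mkOfSucc i).op)

theorem map_map_op (X : SSet.{u}) {a b c : SimplexCategory} (f : a ⟶ b) (g : b ⟶ c)
    (y : X.obj (op c)) : X.map f.op (X.map g.op y) = X.map (f ≫ g).op y := by simp

theorem simplexHom_ext {a b : SimplexCategory} (f g : a ⟶ b) (h : ∀ i, (f i).val = (g i).val) :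
    f = g := by
  apply SimplexCategory.Hom.ext
  apply OrderHom.ext
  funext i
  exact Fin.ext (h i)

theorem δ_val {n : ℕ} (i : Fin (n + 2)) (j : Fin (n + 1)) :
    ((SimplexCategory.δ i : ⦋n⦌ ⟶ ⦋n + 1⦌) j).val = if j.val < i.val then j.val else j.val + 1 := by
  change (Fin.succAbove i j).val = _
  simp only [Fin.succAbove, Fin.lt_def, Fin.val_castSucc]
  split_ifs <;> simp

theorem σ_val {n : ℕ} (i : Fin (n + 1)) (j : Fin (n + 2)) :
    ((SimplexCategory.σ i : ⦋n + 1⦌ ⟶ ⦋n⦌) j).val = if j.val ≤ i.val then j.val else j.val - 1 := by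
  change (Fin.predAbove i j).val = _
  simp only [Fin.predAbove, Fin.lt_def, Fin.val_castSucc]
  split_ifs <;> simp <;> omega

theorem mkOfSucc_val {n : ℕ} (k : Fin n) (i : Fin 2) :
    (SimplexCategory.mkOfSucc k i).val = k.val + i.val := by
  fin_cases i <;> rfl

theorem comp_val {a b c : SimplexCategory} (f : a ⟶ b) (g : b ⟶ c) (i : Fin (a.len + 1)) :
    ((f ≫ g) i).val = (g (f i)).val := rfl

/-- The triangulation with diagonals `0b` and one ear cut off at the vertex `k + 1`. -/
def earChords (n k : ℕ) (a b : Fin (n + 1)) : Prop :=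
  a.val < b.val ∧
    (b.val = a.val + 1 ∨ (a.val = k ∧ b.val = k + 2) ∨ (a.val = 0 ∧ b.val ≠ k + 1))

theorem earChords_isTriangulation (n k : ℕ) (hk : k + 2 ≤ n) :
    IsPolygonTriangulation (earChords n k) where
  lt i j h := h.1
  noncrossing i j k' l h h' := by
    simp only [earChords, Fin.lt_def] at *
    omega
  maximal i j hij H := by
    simp only [earChords, Fin.lt_def] at *
    refine ⟨hij, ?_⟩
    by_contra hc
    by_cases hi : i.val = 0
    · have := (H ⟨k, by omega⟩ ⟨k + 2, by omega⟩ (by simp)).1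
      simp only at this
      omega
    · by_cases hik : i.val = k
      · have := (H ⟨0, by omega⟩ ⟨k + 2, by omega⟩ (by simp)).2
        simp only at this
        omega
      · have := (H ⟨0, by omega⟩ ⟨i.val + 1, by omega⟩ (by simp; omega)).2
        simp only at this
        omega

/-- The triangle with vertices `k, k + 1, k + 2`. -/
def earTriangle {n : ℕ} (k : Fin (n + 1)) : ⦋2⦌ ⟶ ⦋n + 2⦌ :=
  SimplexCategory.subinterval k.val 2 (by omega)

theorem earTriangle_val {n : ℕ} (k : Fin (n + 1)) (i : Fin 3) :
    (earTriangle k i).val = i.val + k.val := rfl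

theorem IsTwoSegal.ext_ear {X : SSet.{u}} (hX : IsTwoSegal X) {n : ℕ} (hn : 2 ≤ n)
    {y y' : X _⦋n⦌}
    (h : ∀ t : PolygonTriangle (earChords n 0), X.map t.1.op y = X.map t.1.op y') : y = y' := by
  by_cases h3 : 3 ≤ n
  · apply (hX n h3 _ (earChords_isTriangulation n 0 (by omega))).1
    apply Subtype.ext
    funext t
    exact h t
  · obtain rfl : n = 2 := by omega
    have := h ⟨𝟙 _, by simp [earChords]⟩
    simpa using this

theorem IsTwoSegal.ear {X : SSet.{u}} (hX : IsTwoSegal X) {m : ℕ} (k : Fin (m + 2))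
    (y : X _⦋m + 2⦌) (t : X _⦋2⦌)
    (h : X.map (SimplexCategory.mkOfSucc k).op y = X.δ 1 t) :
    ∃! w : X _⦋m + 3⦌, X.δ k.succ.castSucc w = y ∧ X.map (earTriangle k).op w = t := by
  have hT := earChords_isTriangulation (m + 3) k.val (by omega)
  have key : ∀ s : PolygonTriangle (earChords (m + 3) k.val),
      (s.1 1).val = k.val + 1 → s.1 = earTriangle k := by
    rintro ⟨s, h01, h12, h02⟩ hs
    simp only [earChords] at h01 h12 h02 hs
    apply simplexHom_ext
    intro i
    rw [earTriangle_val]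
    fin_cases i <;> simp <;> omega
  have avoid : ∀ s : PolygonTriangle (earChords (m + 3) k.val),
      (s.1 1).val ≠ k.val + 1 → ∀ i, (s.1 i).val ≠ k.val + 1 := by
    rintro ⟨s, h01, h12, h02⟩ hs i
    simp only [earChords] at h01 h12 h02 hs
    fin_cases i <;> simp <;> omega
  classical
  let x : PolygonTriangle (earChords (m + 3) k.val) → X _⦋2⦌ := fun s =>
    if (s.1 1).val = k.val + 1 then t else X.map (s.1 ≫ SimplexCategory.σ k.castSucc).op y
  have hmix : ∀ s s' : PolygonTriangle (earChords (m + 3) k.val), ∀ i j : Fin 3,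
      (s.1 1).val = k.val + 1 → (s'.1 1).val ≠ k.val + 1 →
      SimplexCategory.δ i ≫ s.1 = SimplexCategory.δ j ≫ s'.1 → X.δ i (x s) = X.δ j (x s') := by
    intro s s' i j hs hs' he
    have e1 : x s = t := if_pos hs
    have e2 : x s' = X.map (s'.1 ≫ SimplexCategory.σ k.castSucc).op y := if_neg hs'
    rw [e1, e2]
    have hi : i = 1 := by
      have h0 := avoid s' hs' ((SimplexCategory.δ j : ⦋1⦌ ⟶ ⦋2⦌) 0)
      have h1 := avoid s' hs' ((SimplexCategory.δ j : ⦋1⦌ ⟶ ⦋2⦌) 1)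
      have g0 : s.1 ((SimplexCategory.δ i : ⦋1⦌ ⟶ ⦋2⦌) 0) =
        s'.1 ((SimplexCategory.δ j : ⦋1⦌ ⟶ ⦋2⦌) 0) := congrArg (fun f : ⦋1⦌ ⟶ ⦋m + 3⦌ => f 0) he
      have g1 : s.1 ((SimplexCategory.δ i : ⦋1⦌ ⟶ ⦋2⦌) 1) =
        s'.1 ((SimplexCategory.δ j : ⦋1⦌ ⟶ ⦋2⦌) 1) := congrArg (fun f : ⦋1⦌ ⟶ ⦋m + 3⦌ => f 1) he
      rw [← g0] at h0
      rw [← g1] at h1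
      fin_cases i
      · exact absurd hs h0
      · rfl
      · exact absurd hs h1
    subst hi
    rw [← h]
    simp only [SimplicialObject.δ, map_map_op]
    rw [← Category.assoc, ← he, key s hs]
    congr 3
    rw [show SimplexCategory.mkOfSucc k =
      (SimplexCategory.δ 1 ≫ earTriangle k) ≫ SimplexCategory.σ k.castSucc from ?_]
    apply simplexHom_ext
    intro i
    have := i.isLt
    simp only [comp_val, σ_val, earTriangle_val, δ_val, mkOfSucc_val, Fin.val_castSucc, Fin.val_one]
    simp only [SimplexCategory.len_mk] at this
    split_ifs <;> omega
  have hcompat : ∀ (s s' : PolygonTriangle (earChords (m + 3) k.val)) (i j : Fin 3),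
      SimplexCategory.δ i ≫ s.1 = SimplexCategory.δ j ≫ s'.1 → X.δ i (x s) = X.δ j (x s') := by
    intro s s' i j he
    by_cases hs : (s.1 1).val = k.val + 1 <;> by_cases hs' : (s'.1 1).val = k.val + 1
    · have e1 : x s = t := if_pos hs
      have e2 : x s' = t := if_pos hs'
      rw [key s hs, key s' hs'] at he
      rw [e1, e2]
      have g0 : (earTriangle k ((SimplexCategory.δ i : ⦋1⦌ ⟶ ⦋2⦌) 0)).val =
        (earTriangle k ((SimplexCategory.δ j : ⦋1⦌ ⟶ ⦋2⦌) 0)).val :=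
          congrArg (fun f : ⦋1⦌ ⟶ ⦋m + 3⦌ => (f 0).val) he
      have g1 : (earTriangle k ((SimplexCategory.δ i : ⦋1⦌ ⟶ ⦋2⦌) 1)).val =
        (earTriangle k ((SimplexCategory.δ j : ⦋1⦌ ⟶ ⦋2⦌) 1)).val :=
          congrArg (fun f : ⦋1⦌ ⟶ ⦋m + 3⦌ => (f 1).val) he
      simp only [earTriangle_val, δ_val, Fin.val_zero, Fin.val_one] at g0 g1
      obtain rfl : i = j := by
        apply Fin.ext
        split_ifs at g0 g1 <;> omega
      rfl
    · exact hmix s s' i j hs hs' he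
    · exact (hmix s' s j i hs' hs he.symm).symm
    · have e1 : x s = X.map (s.1 ≫ SimplexCategory.σ k.castSucc).op y := if_neg hs
      have e2 : x s' = X.map (s'.1 ≫ SimplexCategory.σ k.castSucc).op y := if_neg hs'
      rw [e1, e2]
      simp only [SimplicialObject.δ, map_map_op]
      rw [← Category.assoc, he, Category.assoc]
  have hb := hX (m + 3) (by omega) _ hT
  obtain ⟨w, hw⟩ := hb.2 ⟨x, hcompat⟩
  have hw' : ∀ s : PolygonTriangle (earChords (m + 3) k.val), X.map s.1.op w = x s :=
    fun s => congrFun (congrArg Subtype.val hw) s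
  refine ⟨w, ⟨?_, ?_⟩, ?_⟩
  · apply hX.ext_ear (by omega)
    intro s
    have hs : earChords (m + 3) k.val ((s.1 ≫ SimplexCategory.δ k.succ.castSucc) 0)
          ((s.1 ≫ SimplexCategory.δ k.succ.castSucc) 1) ∧
        earChords (m + 3) k.val ((s.1 ≫ SimplexCategory.δ k.succ.castSucc) 1)
          ((s.1 ≫ SimplexCategory.δ k.succ.castSucc) 2) ∧
        earChords (m + 3) k.val ((s.1 ≫ SimplexCategory.δ k.succ.castSucc) 0)
          ((s.1 ≫ SimplexCategory.δ k.succ.castSucc) 2) := by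
      obtain ⟨s, h01, h12, h02⟩ := s
      simp only [earChords] at h01 h12 h02
      simp only [earChords, comp_val, δ_val, Fin.val_castSucc, Fin.val_succ]
      refine ⟨?_, ?_, ?_⟩ <;> split_ifs <;> omega
    have e := hw' ⟨_, hs⟩
    simp only [SimplicialObject.δ, map_map_op]
    rw [e]
    have hne : ((s.1 ≫ SimplexCategory.δ k.succ.castSucc) 1).val ≠ k.val + 1 := by
      simp only [comp_val, δ_val, Fin.val_castSucc, Fin.val_succ]
      split_ifs <;> omega
    refine (if_neg hne).trans ?_
    congr 3
    rw [Category.assoc, SimplexCategory.δ_comp_σ_succ' (by simp)]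
    rw [Category.comp_id]
  · have hs : earChords (m + 3) k.val (earTriangle k 0) (earTriangle k 1) ∧
        earChords (m + 3) k.val (earTriangle k 1) (earTriangle k 2) ∧
        earChords (m + 3) k.val (earTriangle k 0) (earTriangle k 2) := by
      simp only [earChords, earTriangle_val]
      simp
      omega
    rw [hw' ⟨_, hs⟩]
    exact if_pos (by simp [earTriangle_val, add_comm])
  · rintro w' ⟨h1, h2⟩
    apply hb.1
    rw [hw]
    apply Subtype.ext
    funext s
    change X.map s.1.op w' = x s
    by_cases hs : (s.1 1).val = k.val + 1
    · rw [key s hs, h2]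
      exact (if_pos hs).symm
    · refine Eq.trans ?_ (if_neg hs).symm
      rw [← h1]
      simp only [SimplicialObject.δ, map_map_op]
      have e : s.1 =
          s.1 ≫ SimplexCategory.σ k.castSucc ≫ SimplexCategory.δ k.succ.castSucc := by
        apply simplexHom_ext
        intro i
        have := avoid s hs i
        simp only [comp_val, σ_val, δ_val, Fin.val_castSucc, Fin.val_succ]
        split_ifs <;> omega
      rw [Category.assoc, ← e]

/-- The structure of a category with set of objects `O` and set of all morphisms `M`; `comp f g` is
"first `f`, then `g`". -/
structure CatStr (O M : Type u) where
  src : M → O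
  tgt : M → O
  one : O → M
  comp : ∀ f g : M, tgt f = src g → M
  src_one : ∀ x, src (one x) = x
  tgt_one : ∀ x, tgt (one x) = x
  src_comp : ∀ f g h, src (comp f g h) = src f
  tgt_comp : ∀ f g h, tgt (comp f g h) = tgt g
  one_comp : ∀ f, comp (one (src f)) f (tgt_one _) = f
  comp_one : ∀ f, comp f (one (tgt f)) (src_one _).symm = f
  assoc : ∀ f g k (hfg : tgt f = src g) (hgk : tgt g = src k),
    comp (comp f g hfg) k ((tgt_comp f g hfg).trans hgk) =
      comp f (comp g k hgk) (hfg.trans (src_comp g k hgk).symm)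

/-- The maps `F₀` on objects and `F₁` on morphisms form a functor. -/
structure CatStr.IsFunctor {O M : Type u} {O' M' : Type v} (C : CatStr O M) (C' : CatStr O' M')
    (F₀ : O → O') (F₁ : M → M') : Prop where
  src : ∀ f, C'.src (F₁ f) = F₀ (C.src f)
  tgt : ∀ f, C'.tgt (F₁ f) = F₀ (C.tgt f)
  one : ∀ x, F₁ (C.one x) = C'.one (F₀ x)
  comp : ∀ f g (h : C.tgt f = C.src g) (h' : C'.tgt (F₁ f) = C'.src (F₁ g)),
    F₁ (C.comp f g h) = C'.comp (F₁ f) (F₁ g) h'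

/-- A (small, strict) double category: a category internal to categories. The category of objects is
`ver`, with objects `Ob` and morphisms `Ver`; the category of morphisms is `vsq`, with objects `Hor`
and morphisms `Sq` (vertical composition of squares; `vsq.src`, `vsq.tgt` are the vertical source and
target, i.e. the top and bottom horizontal morphisms). The internal source, target, identity and
composition are those of `hor` on objects and those of `hsq` on morphisms (horizontal composition of
squares; `hsq.src`, `hsq.tgt` are the horizontal source and target, i.e. the left and right vertical
morphisms). The fields after `vsq` say that source, target, identity and composition are functors.
The proofs `h'`, `h` of composability quantified over there always exist, by the preceding fields. -/
structure DoubleCat where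
  Ob : Type u
  Hor : Type u
  Ver : Type u
  Sq : Type u
  hor : CatStr Ob Hor
  ver : CatStr Ob Ver
  hsq : CatStr Ver Sq
  vsq : CatStr Hor Sq
  src_functor : vsq.IsFunctor ver hor.src hsq.src
  tgt_functor : vsq.IsFunctor ver hor.tgt hsq.tgt
  one_functor : ver.IsFunctor vsq hor.one hsq.one
  comp_src : ∀ a b (h : hsq.tgt a = hsq.src b) (h' : hor.tgt (vsq.src a) = hor.src (vsq.src b)),
    vsq.src (hsq.comp a b h) = hor.comp (vsq.src a) (vsq.src b) h'
  comp_tgt : ∀ a b (h : hsq.tgt a = hsq.src b) (h' : hor.tgt (vsq.tgt a) = hor.src (vsq.tgt b)),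
    vsq.tgt (hsq.comp a b h) = hor.comp (vsq.tgt a) (vsq.tgt b) h'
  comp_one : ∀ f g (h : hor.tgt f = hor.src g) (h' : hsq.tgt (vsq.one f) = hsq.src (vsq.one g)),
    hsq.comp (vsq.one f) (vsq.one g) h' = vsq.one (hor.comp f g h)
  interchange : ∀ a b c d (hab : hsq.tgt a = hsq.src b) (hcd : hsq.tgt c = hsq.src d)
    (hac : vsq.tgt a = vsq.src c) (hbd : vsq.tgt b = vsq.src d)
    (h : vsq.tgt (hsq.comp a b hab) = vsq.src (hsq.comp c d hcd))
    (h' : hsq.tgt (vsq.comp a c hac) = hsq.src (vsq.comp b d hbd)),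
    vsq.comp (hsq.comp a b hab) (hsq.comp c d hcd) h =
      hsq.comp (vsq.comp a c hac) (vsq.comp b d hbd) h'

/-- Stability: `Sq → Hor ×_{Ob} Ver`, `a ↦ (top, left)`, and `Sq → Ver ×_{Ob} Hor`,
`a ↦ (right, bottom)`, are bijections onto the fiber products over sources, resp. targets. -/
structure DoubleCat.IsStable (D : DoubleCat.{u}) : Prop where
  span : ∀ (f : D.Hor) (v : D.Ver), D.hor.src f = D.ver.src v →
    ∃! a : D.Sq, D.vsq.src a = f ∧ D.hsq.src a = v
  cospan : ∀ (v : D.Ver) (f : D.Hor), D.ver.tgt v = D.hor.tgt f →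
    ∃! a : D.Sq, D.hsq.tgt a = v ∧ D.vsq.tgt a = f

/-- `A` is an augmentation: `A ×_{Ob} Hor → Ob` (target of the horizontal morphism) and
`Ver ×_{Ob} A → Ob` (source of the vertical morphism) are bijections. -/
structure DoubleCat.IsAugmented (D : DoubleCat.{u}) (A : Set D.Ob) : Prop where
  hor : ∀ x : D.Ob, ∃! f : D.Hor, D.hor.src f ∈ A ∧ D.hor.tgt f = x
  ver : ∀ x : D.Ob, ∃! v : D.Ver, D.ver.tgt v ∈ A ∧ D.ver.src v = x

/-- Augmented stable double categories. -/
structure AugStDoubleCat extends DoubleCat.{u} where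
  A : Set Ob
  stable : toDoubleCat.IsStable
  augmented : toDoubleCat.IsAugmented A

/-- Augmented double functors: double functors that map the augmentation set into the augmentation
set. The two double categories may live in different universes. -/
@[ext]
structure AugDoubleFunctor (D : AugStDoubleCat.{u}) (E : AugStDoubleCat.{v}) where
  ob : D.Ob → E.Ob
  onHor : D.Hor → E.Hor
  onVer : D.Ver → E.Ver
  onSq : D.Sq → E.Sq
  hor : D.hor.IsFunctor E.hor ob onHor
  ver : D.ver.IsFunctor E.ver ob onVer
  hsq : D.hsq.IsFunctor E.hsq onVer onSq
  vsq : D.vsq.IsFunctor E.vsq onHor onSq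
  aug : ∀ x ∈ D.A, ob x ∈ E.A

theorem CatStr.IsFunctor.id {O M : Type u} (C : CatStr O M) : C.IsFunctor C id id :=
  ⟨fun _ => rfl, fun _ => rfl, fun _ => rfl, fun _ _ _ _ => rfl⟩

theorem CatStr.IsFunctor.trans {O M : Type u} {O' M' : Type v} {O'' M'' : Type w}
    {C : CatStr O M} {C' : CatStr O' M'} {C'' : CatStr O'' M''}
    {F₀ : O → O'} {F₁ : M → M'} {G₀ : O' → O''} {G₁ : M' → M''}
    (hF : C.IsFunctor C' F₀ F₁) (hG : C'.IsFunctor C'' G₀ G₁) :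
    C.IsFunctor C'' (G₀ ∘ F₀) (G₁ ∘ F₁) where
  src f := by simp [hF.src, hG.src]
  tgt f := by simp [hF.tgt, hG.tgt]
  one x := by simp [hF.one, hG.one]
  comp f g h h' := by
    have h1 : C'.tgt (F₁ f) = C'.src (F₁ g) := by rw [hF.tgt, hF.src, h]
    simp only [Function.comp]
    rw [hF.comp f g h h1, hG.comp _ _ h1 h']

/-- The identity double functor. -/
def AugDoubleFunctor.id (D : AugStDoubleCat.{u}) : AugDoubleFunctor D D where
  ob := _root_.id
  onHor := _root_.id
  onVer := _root_.id
  onSq := _root_.id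
  hor := .id _
  ver := .id _
  hsq := .id _
  vsq := .id _
  aug _ h := h

/-- Composition of augmented double functors: first `F`, then `G`. -/
def AugDoubleFunctor.comp {D : AugStDoubleCat.{u}} {E : AugStDoubleCat.{v}} {K : AugStDoubleCat.{w}}
    (F : AugDoubleFunctor D E) (G : AugDoubleFunctor E K) : AugDoubleFunctor D K where
  ob := G.ob ∘ F.ob
  onHor := G.onHor ∘ F.onHor
  onVer := G.onVer ∘ F.onVer
  onSq := G.onSq ∘ F.onSq
  hor := F.hor.trans G.hor
  ver := F.ver.trans G.ver
  hsq := F.hsq.trans G.hsq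
  vsq := F.vsq.trans G.vsq
  aug x h := G.aug _ (F.aug x h)

/-- The category of augmented stable double categories and augmented double functors. -/
instance : Category AugStDoubleCat.{u} where
  Hom D E := AugDoubleFunctor D E
  id D := AugDoubleFunctor.id D
  comp F G := AugDoubleFunctor.comp F G

/-- Objects `(i, j)`, `i ≤ j`, of `W n`. -/
@[ext]
structure WOb (n : ℕ) where
  i : Fin (n + 1)
  j : Fin (n + 1)
  hij : i ≤ j

/-- Horizontal morphisms `(i, j, l) : (i, j) → (i, l)`, `i ≤ j ≤ l`, of `W n`. -/
@[ext]
structure WHor (n : ℕ) where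
  i : Fin (n + 1)
  j : Fin (n + 1)
  l : Fin (n + 1)
  hij : i ≤ j
  hjl : j ≤ l

/-- Vertical morphisms `(i, k, j) : (i, j) → (k, j)`, `i ≤ k ≤ j`, of `W n`. -/
@[ext]
structure WVer (n : ℕ) where
  i : Fin (n + 1)
  k : Fin (n + 1)
  j : Fin (n + 1)
  hik : i ≤ k
  hkj : k ≤ j

/-- Squares `(i, k, j, l)`, `i ≤ k ≤ j ≤ l`, of `W n`, with corners `(i, j)`, `(i, l)`, `(k, j)`,
`(k, l)`. -/
@[ext]
structure WSq (n : ℕ) where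
  i : Fin (n + 1)
  k : Fin (n + 1)
  j : Fin (n + 1)
  l : Fin (n + 1)
  hik : i ≤ k
  hkj : k ≤ j
  hjl : j ≤ l

/-- The category of objects and horizontal morphisms of `W n`. -/
def wHor (n : ℕ) : CatStr (WOb n) (WHor n) where
  src f := ⟨f.i, f.j, f.hij⟩
  tgt f := ⟨f.i, f.l, f.hij.trans f.hjl⟩
  one x := ⟨x.i, x.j, x.j, x.hij, le_rfl⟩
  comp f g h := ⟨f.i, f.j, g.l, f.hij, f.hjl.trans ((congrArg WOb.j h).trans_le g.hjl)⟩
  src_one _ := rfl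
  tgt_one _ := rfl
  src_comp _ _ _ := rfl
  tgt_comp f g h := WOb.ext (show f.i = g.i from congrArg WOb.i h) rfl
  one_comp _ := rfl
  comp_one _ := rfl
  assoc _ _ _ _ _ := rfl

/-- The category of objects and vertical morphisms of `W n`. -/
def wVer (n : ℕ) : CatStr (WOb n) (WVer n) where
  src v := ⟨v.i, v.j, v.hik.trans v.hkj⟩
  tgt v := ⟨v.k, v.j, v.hkj⟩
  one x := ⟨x.i, x.i, x.j, le_rfl, x.hij⟩
  comp v w h := ⟨v.i, w.k, w.j, (v.hik.trans_eq (congrArg WOb.i h)).trans w.hik, w.hkj⟩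
  src_one _ := rfl
  tgt_one _ := rfl
  src_comp _ _ h := WOb.ext rfl (congrArg WOb.j h).symm
  tgt_comp _ _ _ := rfl
  one_comp _ := rfl
  comp_one _ := rfl
  assoc _ _ _ _ _ := rfl

/-- Horizontal composition of squares of `W n`. -/
def wHsq (n : ℕ) : CatStr (WVer n) (WSq n) where
  src a := ⟨a.i, a.k, a.j, a.hik, a.hkj⟩
  tgt a := ⟨a.i, a.k, a.l, a.hik, a.hkj.trans a.hjl⟩
  one v := ⟨v.i, v.k, v.j, v.j, v.hik, v.hkj, le_rfl⟩
  comp a b h := ⟨a.i, a.k, a.j, b.l, a.hik, a.hkj,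
    a.hjl.trans ((congrArg WVer.j h).trans_le b.hjl)⟩
  src_one _ := rfl
  tgt_one _ := rfl
  src_comp _ _ _ := rfl
  tgt_comp a b h := WVer.ext (show a.i = b.i from congrArg WVer.i h)
    (show a.k = b.k from congrArg WVer.k h) rfl
  one_comp _ := rfl
  comp_one _ := rfl
  assoc _ _ _ _ _ := rfl

/-- Vertical composition of squares of `W n`. -/
def wVsq (n : ℕ) : CatStr (WHor n) (WSq n) where
  src a := ⟨a.i, a.j, a.l, a.hik.trans a.hkj, a.hjl⟩
  tgt a := ⟨a.k, a.j, a.l, a.hkj, a.hjl⟩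
  one f := ⟨f.i, f.i, f.j, f.l, le_rfl, f.hij, f.hjl⟩
  comp a b h := ⟨a.i, b.k, b.j, b.l, (a.hik.trans_eq (congrArg WHor.i h)).trans b.hik,
    b.hkj, b.hjl⟩
  src_one _ := rfl
  tgt_one _ := rfl
  src_comp _ _ h := WHor.ext rfl (congrArg WHor.j h).symm (congrArg WHor.l h).symm
  tgt_comp _ _ _ := rfl
  one_comp _ := rfl
  comp_one _ := rfl
  assoc _ _ _ _ _ := rfl

/-- The augmented stable double category `W n`, with augmentation set `{(i, i)}`. -/
def W (n : ℕ) : AugStDoubleCat.{0} where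
  Ob := WOb n
  Hor := WHor n
  Ver := WVer n
  Sq := WSq n
  hor := wHor n
  ver := wVer n
  hsq := wHsq n
  vsq := wVsq n
  src_functor := ⟨fun _ => rfl, fun _ => rfl, fun _ => rfl, fun _ _ _ _ => rfl⟩
  tgt_functor := ⟨fun _ => rfl, fun _ => rfl, fun _ => rfl, fun _ _ _ _ => rfl⟩
  one_functor := ⟨fun _ => rfl, fun _ => rfl, fun _ => rfl, fun _ _ _ _ => rfl⟩
  comp_src _ _ _ _ := rfl
  comp_tgt _ _ _ _ := rfl
  comp_one _ _ _ _ := rfl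
  interchange a b c d hab hcd hac hbd h h' := by
    rfl
  A := {x | x.i = x.j}
  stable :=
    { span := fun f v h => by
        have h1 : f.i = v.i := congrArg WOb.i h
        have h2 : f.j = v.j := congrArg WOb.j h
        refine ⟨⟨v.i, v.k, v.j, f.l, v.hik, v.hkj, h2 ▸ f.hjl⟩, ⟨?_, rfl⟩, ?_⟩
        · exact WHor.ext h1.symm h2.symm rfl
        · rintro a ⟨rfl, rfl⟩
          rfl
      cospan := fun v f h => by
        have h1 : v.k = f.i := congrArg WOb.i h
        have h2 : v.j = f.l := congrArg WOb.j h
        refine ⟨⟨v.i, v.k, f.j, f.l, v.hik, h1 ▸ f.hij, f.hjl⟩, ⟨?_, ?_⟩, ?_⟩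
        · exact WVer.ext rfl rfl h2.symm
        · exact WHor.ext h1 rfl rfl
        · rintro a ⟨rfl, rfl⟩
          rfl }
  augmented :=
    { hor := fun x => by
        refine ⟨⟨x.i, x.i, x.j, le_rfl, x.hij⟩, ⟨rfl, rfl⟩, ?_⟩
        rintro f ⟨h, rfl⟩
        exact WHor.ext rfl (Eq.symm h) rfl
      ver := fun x => by
        refine ⟨⟨x.i, x.j, x.j, x.hij, le_rfl⟩, ⟨rfl, rfl⟩, ?_⟩
        rintro f ⟨h, rfl⟩
        exact WVer.ext rfl h rfl }

/-- The functoriality of `W n` in the ordinal `[n]`. -/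
def W.map {m n : ℕ} (φ : Fin (m + 1) →o Fin (n + 1)) : AugDoubleFunctor (W m) (W n) where
  ob x := ⟨φ x.i, φ x.j, φ.monotone x.hij⟩
  onHor f := ⟨φ f.i, φ f.j, φ f.l, φ.monotone f.hij, φ.monotone f.hjl⟩
  onVer v := ⟨φ v.i, φ v.k, φ v.j, φ.monotone v.hik, φ.monotone v.hkj⟩
  onSq a := ⟨φ a.i, φ a.k, φ a.j, φ a.l, φ.monotone a.hik, φ.monotone a.hkj, φ.monotone a.hjl⟩
  hor := ⟨fun _ => rfl, fun _ => rfl, fun _ => rfl, fun _ _ _ _ => rfl⟩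
  ver := ⟨fun _ => rfl, fun _ => rfl, fun _ => rfl, fun _ _ _ _ => rfl⟩
  hsq := ⟨fun _ => rfl, fun _ => rfl, fun _ => rfl, fun _ _ _ _ => rfl⟩
  vsq := ⟨fun _ => rfl, fun _ => rfl, fun _ => rfl, fun _ _ _ _ => rfl⟩
  aug _ h := congrArg φ h

/-- The cosimplicial augmented stable double category `[n] ↦ W n`. -/
def wFunctor : SimplexCategory ⥤ AugStDoubleCat.{0} where
  obj n := W n.len
  map φ := W.map φ.toOrderHom

/-- The functor `Hom(-, D)`, restricted to double categories in the lowest universe. -/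
def homInto (D : AugStDoubleCat.{u}) : AugStDoubleCat.{0}ᵒᵖ ⥤ Type u where
  obj C := AugDoubleFunctor C.unop D
  map F := ↾(fun G => AugDoubleFunctor.comp F.unop G)

/-- Postcomposition `Hom(-, D) → Hom(-, E)`. -/
def homIntoMap {D E : AugStDoubleCat.{u}} (G : D ⟶ E) : homInto D ⟶ homInto E where
  app C := ↾(fun F => AugDoubleFunctor.comp F G)

/-- The functor `D ↦ Hom(-, D)`. -/
def homIntoFunctor : AugStDoubleCat.{u} ⥤ AugStDoubleCat.{0}ᵒᵖ ⥤ Type u where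
  obj D := homInto D
  map G := homIntoMap G

/-- The category `Σ`: the product `Δ × Δ` with a new terminal object `[-1]` added. -/
abbrev SigmaCat := WithTerminal (SimplexCategory × SimplexCategory)

/-- The ordinal sum `f + g : [a] + [b] → [c] + [d]` of two monotone maps, with `[a] + [b] = [a + 1 + b]`. -/
def ordinalSumHom {a b c d : ℕ} (f : Fin (a + 1) →o Fin (c + 1)) (g : Fin (b + 1) →o Fin (d + 1)) :
    Fin (a + 1 + b + 1) →o Fin (c + 1 + d + 1) where
  toFun i := if h : i.val < a + 1 then ⟨(f ⟨i.val, h⟩).val, by omega⟩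
    else ⟨c + 1 + (g ⟨i.val - (a + 1), by omega⟩).val, by omega⟩
  monotone' i j hij := by
    have hij' : i.val ≤ j.val := hij
    dsimp only
    split_ifs with h1 h2 h2
    · exact f.monotone (show (⟨i.val, h1⟩ : Fin (a + 1)) ≤ ⟨j.val, h2⟩ from hij')
    · rw [Fin.le_def]; dsimp only; omega
    · omega
    · have := g.monotone (show (⟨i.val - (a + 1), by omega⟩ : Fin (b + 1)) ≤
        ⟨j.val - (a + 1), by omega⟩ from Nat.sub_le_sub_right hij' _)
      rw [Fin.le_def] at this ⊢
      dsimp only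
      omega

/-- The ordinal sum functor `Δ × Δ → Δ`. -/
def ordinalSum : SimplexCategory × SimplexCategory ⥤ SimplexCategory where
  obj x := ⦋x.1.len + 1 + x.2.len⦌
  map f := SimplexCategory.mkHom (ordinalSumHom f.1.toOrderHom f.2.toOrderHom)
  map_id x := by
    apply simplexHom_ext
    intro i
    change (ordinalSumHom (OrderHom.id) (OrderHom.id) i).val = i.val
    simp only [ordinalSumHom, OrderHom.coe_mk, OrderHom.id_coe, id]
    split_ifs
    · rfl
    · simp only
      omega
  map_comp {x _ _} f g := by
    apply simplexHom_ext
    intro i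
    change (ordinalSumHom (g.1.toOrderHom.comp f.1.toOrderHom)
      (g.2.toOrderHom.comp f.2.toOrderHom) i).val =
      (ordinalSumHom g.1.toOrderHom g.2.toOrderHom
        (ordinalSumHom f.1.toOrderHom f.2.toOrderHom i)).val
    by_cases h : i.val < x.1.len + 1
    · have h1 : ordinalSumHom f.1.toOrderHom f.2.toOrderHom i = ⟨_, _⟩ := dif_pos h
      rw [h1]
      refine (congrArg Fin.val (dif_pos h)).trans
        (Eq.trans ?_ (congrArg Fin.val (dif_pos ?_)).symm)
      rfl
    · have h1 : ordinalSumHom f.1.toOrderHom f.2.toOrderHom i = ⟨_, _⟩ := dif_neg h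
      rw [h1]
      refine (congrArg Fin.val (dif_neg h)).trans
        (Eq.trans ?_ (congrArg Fin.val (dif_neg ?_)).symm)
      · simp
      · simp only
        omega

/-- The functor `p : Σ → Δ` that extends the ordinal sum: `p(q, r) = [q + 1 + r]`, `p(-1) = [0]`, and
`(q, r) → [-1]` is mapped to the unique map to `[0]`. -/
def ordinalSumExt : SigmaCat ⥤ SimplexCategory :=
  WithTerminal.liftToTerminal ordinalSum SimplexCategory.isTerminalZero

/-- Preaugmented bisimplicial sets: functors `Σᵒᵖ → Set`. -/
abbrev PreaugBisimplicialSet := SigmaCatᵒᵖ ⥤ Type u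

/-- The generalized path construction `p^*`: precomposition with `p`. -/
def pUpper : SSet.{u} ⥤ PreaugBisimplicialSet.{u} :=
  (Functor.whiskeringLeft _ _ _).obj ordinalSumExt.op

/-- The generalized Waldhausen construction `p_*`: right Kan extension along `p`. -/
noncomputable def pLower : PreaugBisimplicialSet.{u} ⥤ SSet.{u} := ordinalSumExt.op.ran

/-- The adjunction `p^* ⊣ p_*`. -/
noncomputable def pAdjunction : pUpper.{u} ⊣ pLower.{u} := ordinalSumExt.op.ranAdjunction (Type u)

/-- The augmented double nerve `N^a`: the functor `Hom(-, D)` applied to `Σ → Δ → DCat`,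
the composite of `p` and `[n] ↦ W n`. -/
def augNerve : AugStDoubleCat.{u} ⥤ PreaugBisimplicialSet.{u} :=
  homIntoFunctor ⋙ (Functor.whiskeringLeft _ _ _).obj (ordinalSumExt ⋙ wFunctor).op

/-- The Waldhausen construction `S_•`, as a functor to simplicial sets: `S_n D = Hom(W n, D)`. -/
def waldhausenConstruction : AugStDoubleCat.{u} ⥤ SSet.{u} :=
  homIntoFunctor ⋙ (Functor.whiskeringLeft _ _ _).obj wFunctor.op

theorem map_map_eq (X : SSet.{u}) {a b b' c : SimplexCategory} {f : a ⟶ b} {g : b ⟶ c}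
    {f' : a ⟶ b'} {g' : b' ⟶ c} (h : f ≫ g = f' ≫ g') (y : X.obj (op c)) :
    X.map f.op (X.map g.op y) = X.map f'.op (X.map g'.op y) := by
  rw [map_map_op, map_map_op, h]

theorem map_map_eq_self (X : SSet.{u}) {a b : SimplexCategory} {f : a ⟶ b} {g : b ⟶ a}
    (h : f ≫ g = 𝟙 a) (y : X.obj (op a)) : X.map f.op (X.map g.op y) = y := by
  rw [map_map_op, h]; simp

/-- A category structure whose composition is defined by unique fillers: `T` is a set of "composable
pairs with a composite", `fst`, `snd`, `cmp` extract the two morphisms and their composite, every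
composable pair `f`, `g` has a unique filler `z` in `T`, and the composite of `f` and `g` is `cmp z`.
The elements `L f` and `R f` of `T` and the hypothesis `assoc` give the unit and associativity laws. -/
noncomputable def CatStr.ofFillers {O M T : Type u} (s t : M → O) (e : O → M)
    (fst snd cmp : T → M) (L R : M → T)
    (s_e : ∀ x, s (e x) = x) (t_e : ∀ x, t (e x) = x)
    (s_cmp : ∀ z, s (cmp z) = s (fst z)) (t_cmp : ∀ z, t (cmp z) = t (snd z))
    (fst_L : ∀ f, fst (L f) = e (s f)) (snd_L : ∀ f, snd (L f) = f) (cmp_L : ∀ f, cmp (L f) = f)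
    (fst_R : ∀ f, fst (R f) = f) (snd_R : ∀ f, snd (R f) = e (t f)) (cmp_R : ∀ f, cmp (R f) = f)
    (fill : ∀ f g, t f = s g → ∃! z, fst z = f ∧ snd z = g)
    (assoc : ∀ f g k, t f = s g → t g = s k → ∃ z₁ z₂ z₃ z₄,
      (fst z₁ = f ∧ snd z₁ = g) ∧ (fst z₂ = cmp z₁ ∧ snd z₂ = k) ∧
      (fst z₃ = g ∧ snd z₃ = k) ∧ (fst z₄ = f ∧ snd z₄ = cmp z₃) ∧ cmp z₂ = cmp z₄) : CatStr O M :=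
  have key : ∀ z z', fst z = fst z' → snd z = snd z' → t (fst z') = s (snd z') → z = z' :=
    fun z z' h1 h2 h => (fill _ _ h).unique ⟨h1, h2⟩ ⟨rfl, rfl⟩
  { src := s
    tgt := t
    one := e
    comp := fun f g h => cmp (fill f g h).choose
    src_one := s_e
    tgt_one := t_e
    src_comp := fun f g h => by rw [s_cmp, (fill f g h).choose_spec.1.1]
    tgt_comp := fun f g h => by rw [t_cmp, (fill f g h).choose_spec.1.2]
    one_comp := fun f => by
      have h := (fill (e (s f)) f (t_e _)).choose_spec.1
      rw [key _ (L f) (h.1.trans (fst_L f).symm) (h.2.trans (snd_L f).symm)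
        (by rw [fst_L, snd_L, t_e]), cmp_L]
    comp_one := fun f => by
      have h := (fill f (e (t f)) (s_e _).symm).choose_spec.1
      rw [key _ (R f) (h.1.trans (fst_R f).symm) (h.2.trans (snd_R f).symm)
        (by rw [fst_R, snd_R, s_e]), cmp_R]
    assoc := fun f g k hfg hgk => by
      obtain ⟨z₁, z₂, z₃, z₄, h1, h2, h3, h4, e⟩ := assoc f g k hfg hgk
      obtain rfl : (fill f g hfg).choose = z₁ := ((fill f g hfg).choose_spec.2 z₁ h1).symm
      obtain rfl : (fill g k hgk).choose = z₃ := ((fill g k hgk).choose_spec.2 z₃ h3).symm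
      exact (congrArg cmp ((fill _ k (by rw [t_cmp, h1.2, hgk])).choose_spec.2 z₂ h2).symm).trans
        (e.trans (congrArg cmp ((fill f _ (by rw [s_cmp, h3.1, hfg])).choose_spec.2 z₄ h4))) }

section Path

variable {X : SSet.{u}}

theorem map_id_op (X : SSet.{u}) {a : SimplexCategory} (y : X.obj (op a)) :
    X.map (𝟙 a).op y = y := by simp

theorem face_face (X : SSet.{u}) {n : ℕ} {i i' : Fin (n + 2)} {j j' : Fin (n + 3)}
    (h : SimplexCategory.δ i ≫ SimplexCategory.δ j = SimplexCategory.δ i' ≫ SimplexCategory.δ j')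
    (y : X _⦋n + 2⦌) : X.δ i (X.δ j y) = X.δ i' (X.δ j' y) :=
  map_map_eq X h y

theorem IsTwoSegal.ear' (hX : IsTwoSegal X) {m : ℕ} (k : Fin (m + 2)) {c : SimplexCategory}
    {d : ⦋m + 2⦌ ⟶ ⦋m + 3⦌} {r : ⦋2⦌ ⟶ c} {s : c ⟶ ⦋m + 3⦌} {e : ⦋1⦌ ⟶ ⦋m + 2⦌}
    {e' : ⦋1⦌ ⟶ c}
    (hd : d = SimplexCategory.δ k.succ.castSucc) (ht : r ≫ s = earTriangle k)
    (he : e = SimplexCategory.mkOfSucc k) (y : X _⦋m + 2⦌) (t : X.obj (op c))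
    (he' : SimplexCategory.δ 1 ≫ r = e')
    (h : X.map e.op y = X.map e'.op t) :
    ∃ w : X _⦋m + 3⦌, X.map d.op w = y ∧ X.map r.op (X.map s.op w) = X.map r.op t ∧
      ∀ w', X.map d.op w' = y → X.map r.op (X.map s.op w') = X.map r.op t → w' = w := by
  subst hd he he'
  obtain ⟨w, ⟨h1, h2⟩, h3⟩ := hX.ear k y (X.map r.op t) (by
    rw [h]; simp only [SimplicialObject.δ, map_map_op])
  refine ⟨w, h1, by rw [map_map_op, ht, h2], fun w' h1' h2' => h3 w' ⟨h1', ?_⟩⟩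
  rw [← ht, ← map_map_op, h2']

theorem fill_hor (hX : IsTwoSegal X) (f g : X _⦋2⦌) (h : X.δ 1 f = X.δ 2 g) :
    ∃! z : X _⦋3⦌, X.δ 3 z = f ∧ X.δ 1 z = g := by
  obtain ⟨w, h1, h2, h3⟩ := hX.ear' (m := 0) 0 (d := SimplexCategory.δ 1) (r := 𝟙 _)
    (s := SimplexCategory.δ 3) (e := SimplexCategory.δ 2) (e' := SimplexCategory.δ 1)
    (by decide) (by decide) (by decide) g f (by decide) h.symm
  simp only [map_id_op] at h2 h3
  exact ⟨w, ⟨h2, h1⟩, fun w' h' => h3 w' h'.2 h'.1⟩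

theorem fill_ver (hX : IsTwoSegal X) (f g : X _⦋2⦌) (h : X.δ 0 f = X.δ 1 g) :
    ∃! z : X _⦋3⦌, X.δ 2 z = f ∧ X.δ 0 z = g := by
  obtain ⟨w, h1, h2, h3⟩ := hX.ear' (m := 0) 1 (d := SimplexCategory.δ 2) (r := 𝟙 _)
    (s := SimplexCategory.δ 0) (e := SimplexCategory.δ 0) (e' := SimplexCategory.δ 1)
    (by decide) (by decide) (by decide) f g (by decide) h
  simp only [map_id_op] at h2 h3
  exact ⟨w, ⟨h1, h2⟩, fun w' h' => h3 w' h'.1 h'.2⟩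

theorem ext_hor (hX : IsTwoSegal X) {z z' : X _⦋3⦌} (h₁ : X.δ 1 z = X.δ 1 z')
    (h₂ : X.δ 3 z = X.δ 3 z') : z = z' :=
  (fill_hor hX (X.δ 3 z') (X.δ 1 z') (face_face X (by decide) z')).unique ⟨h₂, h₁⟩ ⟨rfl, rfl⟩

theorem ext_ver (hX : IsTwoSegal X) {z z' : X _⦋3⦌} (h₁ : X.δ 2 z = X.δ 2 z')
    (h₂ : X.δ 0 z = X.δ 0 z') : z = z' :=
  (fill_ver hX (X.δ 2 z') (X.δ 0 z') (face_face X (by decide) z')).unique ⟨h₁, h₂⟩ ⟨rfl, rfl⟩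

theorem fill_hsq (hX : IsTwoSegal X) (f g : X _⦋3⦌) (h : X.δ 2 f = X.δ 3 g) :
    ∃! z : X _⦋4⦌, X.δ 4 z = f ∧ X.δ 2 z = g := by
  obtain ⟨w, h1, h2, h3⟩ := hX.ear' (m := 1) 1 (d := SimplexCategory.δ 2)
    (r := SimplexCategory.δ 0) (s := SimplexCategory.δ 4)
    (e := SimplexCategory.δ 0 ≫ SimplexCategory.δ 3)
    (e' := SimplexCategory.δ 0 ≫ SimplexCategory.δ 2)
    (by decide) (by decide) (by decide) g f (by decide)
    (by
      rw [← map_map_op, ← map_map_op]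
      exact congrArg (X.δ (0 : Fin 3)) h.symm)
  refine ⟨w, ⟨ext_ver hX ?_ h2, h1⟩, fun w' h' => h3 w' h'.2 (congrArg (X.δ (0 : Fin 4)) h'.1)⟩
  exact ((face_face X (by decide) w).trans (congrArg (X.δ (3 : Fin 4)) h1)).trans h.symm

theorem fill_vsq (hX : IsTwoSegal X) (f g : X _⦋3⦌) (h : X.δ 0 f = X.δ 1 g) :
    ∃! z : X _⦋4⦌, X.δ 2 z = f ∧ X.δ 0 z = g := by
  obtain ⟨w, h1, h2, h3⟩ := hX.ear' (m := 1) 1 (d := SimplexCategory.δ 2)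
    (r := SimplexCategory.δ 3) (s := SimplexCategory.δ 0)
    (e := SimplexCategory.δ 2 ≫ SimplexCategory.δ 0)
    (e' := SimplexCategory.δ 2 ≫ SimplexCategory.δ 1)
    (by decide) (by decide) (by decide) f g (by decide)
    (by
      rw [← map_map_op, ← map_map_op]
      exact congrArg (X.δ (2 : Fin 3)) h)
  refine ⟨w, ⟨h1, ext_hor hX ?_ h2⟩, fun w' h' => h3 w' h'.1 (congrArg (X.δ (3 : Fin 4)) h'.2)⟩
  exact ((face_face X (by decide) w).trans (congrArg (X.δ (0 : Fin 4)) h1)).trans h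

theorem fill_hsq₃ (hX : IsTwoSegal X) (f g : X _⦋4⦌) (h : X.δ 3 f = X.δ 4 g) :
    ∃ z : X _⦋5⦌, X.δ 5 z = f ∧ X.δ 3 z = g := by
  obtain ⟨w, h1, h2, -⟩ := hX.ear' (m := 2) 2 (d := SimplexCategory.δ 3)
    (r := SimplexCategory.δ 0 ≫ SimplexCategory.δ 0) (s := SimplexCategory.δ 5)
    (e := (SimplexCategory.δ 0 ≫ SimplexCategory.δ 0) ≫ SimplexCategory.δ 4)
    (e' := (SimplexCategory.δ 0 ≫ SimplexCategory.δ 0) ≫ SimplexCategory.δ 3)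
    (by decide) (by decide) (by decide) g f (by decide)
    (by
      have := congrArg (X.map (SimplexCategory.δ (0 : Fin 3) ≫ SimplexCategory.δ (0 : Fin 4)).op)
        h.symm
      simp only [SimplicialObject.δ, map_map_op] at this
      exact this)
  refine ⟨w, ?_, h1⟩
  have h4 : X.δ 3 (X.δ 5 w) = X.δ 3 f :=
    ((face_face X (by decide) w).trans (congrArg (X.δ (4 : Fin 5)) h1)).trans h.symm
  obtain ⟨u, -, -, h3⟩ := hX.ear' (m := 1) 2 (d := SimplexCategory.δ 3)
    (r := SimplexCategory.δ 0) (s := SimplexCategory.δ 0)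
    (e := SimplexCategory.δ 0 ≫ SimplexCategory.δ 0)
    (e' := SimplexCategory.δ 0 ≫ SimplexCategory.δ 2)
    (by decide) (by decide) (by decide) (X.δ (3 : Fin 5) f) (X.δ (0 : Fin 5) f) (by decide)
    (by
      simp only [SimplicialObject.δ, map_map_op]
      exact congrArg (fun a => X.map (Quiver.Hom.op a) f) (by decide))
  rw [h3 f rfl rfl]
  refine h3 _ h4 ?_
  simp only [SimplicialObject.δ, map_map_op] at h2 ⊢
  exact h2

theorem fill_vsq₃ (hX : IsTwoSegal X) (f g : X _⦋4⦌) (h : X.δ 0 f = X.δ 1 g) :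
    ∃ z : X _⦋5⦌, X.δ 2 z = f ∧ X.δ 0 z = g := by
  obtain ⟨w, h1, h2, -⟩ := hX.ear' (m := 2) 1 (d := SimplexCategory.δ 2)
    (r := SimplexCategory.δ 3 ≫ SimplexCategory.δ 3) (s := SimplexCategory.δ 0)
    (e := (SimplexCategory.δ 2 ≫ SimplexCategory.δ 2) ≫ SimplexCategory.δ 0)
    (e' := (SimplexCategory.δ 2 ≫ SimplexCategory.δ 2) ≫ SimplexCategory.δ 1)
    (by decide) (by decide) (by decide) f g (by decide)
    (by
      have := congrArg (X.map (SimplexCategory.δ (2 : Fin 3) ≫ SimplexCategory.δ (2 : Fin 4)).op) h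
      simp only [SimplicialObject.δ, map_map_op] at this
      exact this)
  refine ⟨w, h1, ?_⟩
  have h4 : X.δ 1 (X.δ 0 w) = X.δ 1 g :=
    ((face_face X (by decide) w).trans (congrArg (X.δ (0 : Fin 5)) h1)).trans h
  obtain ⟨u, -, -, h3⟩ := hX.ear' (m := 1) 0 (d := SimplexCategory.δ 1)
    (r := SimplexCategory.δ 3) (s := SimplexCategory.δ 3)
    (e := SimplexCategory.δ 2 ≫ SimplexCategory.δ 2)
    (e' := SimplexCategory.δ 1 ≫ SimplexCategory.δ 3)
    (by decide) (by decide) (by decide) (X.δ (1 : Fin 5) g) (X.δ (3 : Fin 5) g) (by decide)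
    (by
      simp only [SimplicialObject.δ, map_map_op]
      exact congrArg (fun a => X.map (Quiver.Hom.op a) g) (by decide))
  rw [h3 g rfl rfl]
  refine h3 _ h4 ?_
  simp only [SimplicialObject.δ, map_map_op] at h2 ⊢
  exact h2

theorem deg_face (X : SSet.{u}) {n : ℕ} {i : Fin (n + 2)} {j : Fin (n + 1)}
    (h : SimplexCategory.δ i ≫ SimplexCategory.σ j = 𝟙 ⦋n⦌) (y : X _⦋n⦌) :
    X.δ i (X.σ j y) = y :=
  map_map_eq_self X h y

theorem face_deg (X : SSet.{u}) {n : ℕ} {i : Fin (n + 3)} {j : Fin (n + 2)}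
    {i' : Fin (n + 2)} {j' : Fin (n + 1)}
    (h : SimplexCategory.δ i ≫ SimplexCategory.σ j = SimplexCategory.σ j' ≫ SimplexCategory.δ i')
    (y : X _⦋n + 1⦌) : X.δ i (X.σ j y) = X.σ j' (X.δ i' y) :=
  map_map_eq X h y

/-- Objects `X₁`, morphisms `X₂`; source `d₂`, target `d₁`, identity `s₁`. The composite is `d₂ z` for
the unique 3-simplex `z` with `d₃ z` the first and `d₁ z` the second morphism. -/
noncomputable def pathHor (hX : IsTwoSegal X) : CatStr (X _⦋1⦌) (X _⦋2⦌) :=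
  CatStr.ofFillers (X.δ 2) (X.δ 1) (X.σ 1) (X.δ (3 : Fin 4)) (X.δ (1 : Fin 4)) (X.δ (2 : Fin 4))
    (X.σ (1 : Fin 3)) (X.σ (2 : Fin 3))
    (deg_face X (by decide)) (deg_face X (by decide))
    (face_face X (by decide)) (face_face X (by decide))
    (face_deg X (by decide)) (deg_face X (by decide)) (deg_face X (by decide))
    (deg_face X (by decide)) (face_deg X (by decide)) (deg_face X (by decide))
    (fill_hor hX)
    (fun f g k hfg hgk => by
      obtain ⟨z₁, ⟨rfl, rfl⟩, -⟩ := fill_hor hX f g hfg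
      obtain ⟨z₂, ⟨h, rfl⟩, -⟩ := fill_hor hX (X.δ (2 : Fin 4) z₁) k
        ((face_face X (by decide) z₁).trans hgk)
      obtain ⟨w, ⟨rfl, rfl⟩, -⟩ := fill_hsq hX z₁ z₂ h.symm
      exact ⟨_, _, X.δ (1 : Fin 5) w, X.δ (3 : Fin 5) w, ⟨rfl, rfl⟩, ⟨h, rfl⟩,
        ⟨face_face X (by decide) w, face_face X (by decide) w⟩,
        ⟨face_face X (by decide) w, face_face X (by decide) w⟩, face_face X (by decide) w⟩)

/-- Objects `X₁`, morphisms `X₂`; source `d₁`, target `d₀`, identity `s₀`. The composite is `d₁ z` for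
the unique 3-simplex `z` with `d₂ z` the first and `d₀ z` the second morphism. -/
noncomputable def pathVer (hX : IsTwoSegal X) : CatStr (X _⦋1⦌) (X _⦋2⦌) :=
  CatStr.ofFillers (X.δ 1) (X.δ 0) (X.σ 0) (X.δ (2 : Fin 4)) (X.δ (0 : Fin 4)) (X.δ (1 : Fin 4))
    (X.σ (0 : Fin 3)) (X.σ (1 : Fin 3))
    (deg_face X (by decide)) (deg_face X (by decide))
    (face_face X (by decide)) (face_face X (by decide))
    (face_deg X (by decide)) (deg_face X (by decide)) (deg_face X (by decide))
    (deg_face X (by decide)) (face_deg X (by decide)) (deg_face X (by decide))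
    (fill_ver hX)
    (fun f g k hfg hgk => by
      obtain ⟨z₃, ⟨rfl, rfl⟩, -⟩ := fill_ver hX g k hgk
      obtain ⟨z₄, ⟨rfl, h⟩, -⟩ := fill_ver hX f (X.δ (1 : Fin 4) z₃)
        (hfg.trans (face_face X (by decide) z₃))
      obtain ⟨w, ⟨rfl, rfl⟩, -⟩ := fill_vsq hX z₄ z₃ h
      exact ⟨X.δ (3 : Fin 5) w, X.δ (1 : Fin 5) w, _, _,
        ⟨face_face X (by decide) w, face_face X (by decide) w⟩,
        ⟨face_face X (by decide) w, face_face X (by decide) w⟩, ⟨rfl, rfl⟩, ⟨rfl, h⟩,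
        face_face X (by decide) w⟩)

/-- Objects `X₂`, morphisms `X₃`; source `d₃`, target `d₂`, identity `s₂`. The composite is `d₃ z` for
the unique 4-simplex `z` with `d₄ z` the first and `d₂ z` the second morphism. -/
noncomputable def pathHsq (hX : IsTwoSegal X) : CatStr (X _⦋2⦌) (X _⦋3⦌) :=
  CatStr.ofFillers (X.δ 3) (X.δ 2) (X.σ 2) (X.δ (4 : Fin 5)) (X.δ (2 : Fin 5)) (X.δ (3 : Fin 5))
    (X.σ (2 : Fin 4)) (X.σ (3 : Fin 4))
    (deg_face X (by decide)) (deg_face X (by decide))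
    (face_face X (by decide)) (face_face X (by decide))
    (face_deg X (by decide)) (deg_face X (by decide)) (deg_face X (by decide))
    (deg_face X (by decide)) (face_deg X (by decide)) (deg_face X (by decide))
    (fill_hsq hX)
    (fun f g k hfg hgk => by
      obtain ⟨z₁, ⟨rfl, rfl⟩, -⟩ := fill_hsq hX f g hfg
      obtain ⟨z₂, ⟨h, rfl⟩, -⟩ := fill_hsq hX (X.δ (3 : Fin 5) z₁) k
        ((face_face X (by decide) z₁).trans hgk)
      obtain ⟨w, rfl, rfl⟩ := fill_hsq₃ hX z₁ z₂ h.symm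
      exact ⟨_, _, X.δ (2 : Fin 6) w, X.δ (4 : Fin 6) w, ⟨rfl, rfl⟩, ⟨h, rfl⟩,
        ⟨face_face X (by decide) w, face_face X (by decide) w⟩,
        ⟨face_face X (by decide) w, face_face X (by decide) w⟩, face_face X (by decide) w⟩)

/-- Objects `X₂`, morphisms `X₃`; source `d₁`, target `d₀`, identity `s₀`. The composite is `d₁ z` for
the unique 4-simplex `z` with `d₂ z` the first and `d₀ z` the second morphism. -/
noncomputable def pathVsq (hX : IsTwoSegal X) : CatStr (X _⦋2⦌) (X _⦋3⦌) :=
  CatStr.ofFillers (X.δ 1) (X.δ 0) (X.σ 0) (X.δ (2 : Fin 5)) (X.δ (0 : Fin 5)) (X.δ (1 : Fin 5))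
    (X.σ (0 : Fin 4)) (X.σ (1 : Fin 4))
    (deg_face X (by decide)) (deg_face X (by decide))
    (face_face X (by decide)) (face_face X (by decide))
    (face_deg X (by decide)) (deg_face X (by decide)) (deg_face X (by decide))
    (deg_face X (by decide)) (face_deg X (by decide)) (deg_face X (by decide))
    (fill_vsq hX)
    (fun f g k hfg hgk => by
      obtain ⟨z₃, ⟨rfl, rfl⟩, -⟩ := fill_vsq hX g k hgk
      obtain ⟨z₄, ⟨rfl, h⟩, -⟩ := fill_vsq hX f (X.δ (1 : Fin 5) z₃)
        (hfg.trans (face_face X (by decide) z₃))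
      obtain ⟨w, rfl, rfl⟩ := fill_vsq₃ hX z₄ z₃ h
      exact ⟨X.δ (3 : Fin 6) w, X.δ (1 : Fin 6) w, _, _,
        ⟨face_face X (by decide) w, face_face X (by decide) w⟩,
        ⟨face_face X (by decide) w, face_face X (by decide) w⟩, ⟨rfl, rfl⟩, ⟨rfl, h⟩,
        face_face X (by decide) w⟩)

theorem pathHor_comp (hX : IsTwoSegal X) {f g : X _⦋2⦌} (z : X _⦋3⦌)
    (hf : X.δ 3 z = f) (hg : X.δ 1 z = g) (h : (pathHor hX).tgt f = (pathHor hX).src g) :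
    (pathHor hX).comp f g h = X.δ 2 z :=
  congrArg (X.δ 2) ((fill_hor hX f g h).choose_spec.2 z ⟨hf, hg⟩).symm

theorem pathVer_comp (hX : IsTwoSegal X) {f g : X _⦋2⦌} (z : X _⦋3⦌)
    (hf : X.δ 2 z = f) (hg : X.δ 0 z = g) (h : (pathVer hX).tgt f = (pathVer hX).src g) :
    (pathVer hX).comp f g h = X.δ 1 z :=
  congrArg (X.δ 1) ((fill_ver hX f g h).choose_spec.2 z ⟨hf, hg⟩).symm

theorem pathHsq_comp (hX : IsTwoSegal X) {f g : X _⦋3⦌} (z : X _⦋4⦌)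
    (hf : X.δ 4 z = f) (hg : X.δ 2 z = g) (h : (pathHsq hX).tgt f = (pathHsq hX).src g) :
    (pathHsq hX).comp f g h = X.δ 3 z :=
  congrArg (X.δ 3) ((fill_hsq hX f g h).choose_spec.2 z ⟨hf, hg⟩).symm

theorem pathVsq_comp (hX : IsTwoSegal X) {f g : X _⦋3⦌} (z : X _⦋4⦌)
    (hf : X.δ 2 z = f) (hg : X.δ 0 z = g) (h : (pathVsq hX).tgt f = (pathVsq hX).src g) :
    (pathVsq hX).comp f g h = X.δ 1 z :=
  congrArg (X.δ 1) ((fill_vsq hX f g h).choose_spec.2 z ⟨hf, hg⟩).symm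

/-- The double category of the path construction: `Ob = X₁`, `Hor = Ver = X₂`, `Sq = X₃`. -/
noncomputable def pathDoubleCat (hX : IsTwoSegal X) : DoubleCat.{u} where
  Ob := X _⦋1⦌
  Hor := X _⦋2⦌
  Ver := X _⦋2⦌
  Sq := X _⦋3⦌
  hor := pathHor hX
  ver := pathVer hX
  hsq := pathHsq hX
  vsq := pathVsq hX
  src_functor :=
    { src := fun a => face_face X (by decide) a
      tgt := fun a => face_face X (by decide) a
      one := fun f => face_deg X (by decide) f
      comp := fun a b h h' => by
        obtain ⟨w, ⟨rfl, rfl⟩, -⟩ := fill_vsq hX a b h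
        rw [pathVsq_comp hX w rfl rfl]
        refine Eq.trans ?_ (pathVer_comp hX (X.δ 4 w) ?_ ?_ h').symm <;>
          exact face_face X (by decide) w }
  tgt_functor :=
    { src := fun a => face_face X (by decide) a
      tgt := fun a => face_face X (by decide) a
      one := fun f => face_deg X (by decide) f
      comp := fun a b h h' => by
        obtain ⟨w, ⟨rfl, rfl⟩, -⟩ := fill_vsq hX a b h
        rw [pathVsq_comp hX w rfl rfl]
        refine Eq.trans ?_ (pathVer_comp hX (X.δ 3 w) ?_ ?_ h').symm <;>
          exact face_face X (by decide) w }
  one_functor :=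
    { src := fun v => face_deg X (by decide) v
      tgt := fun v => face_deg X (by decide) v
      one := fun x => map_map_eq X (by decide) x
      comp := fun a b h h' => by
        obtain ⟨w, ⟨rfl, rfl⟩, -⟩ := fill_ver hX a b h
        rw [pathVer_comp hX w rfl rfl]
        refine Eq.trans ?_ (pathVsq_comp hX (X.σ 3 w) ?_ ?_ h').symm
        · exact (face_deg X (by decide) w).symm
        · exact face_deg X (by decide) w
        · exact face_deg X (by decide) w }
  comp_src := fun a b h h' => by
    obtain ⟨w, ⟨rfl, rfl⟩, -⟩ := fill_hsq hX a b h
    rw [pathHsq_comp hX w rfl rfl]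
    refine Eq.trans ?_ (pathHor_comp hX (X.δ 1 w) ?_ ?_ h').symm <;>
      exact face_face X (by decide) w
  comp_tgt := fun a b h h' => by
    obtain ⟨w, ⟨rfl, rfl⟩, -⟩ := fill_hsq hX a b h
    rw [pathHsq_comp hX w rfl rfl]
    refine Eq.trans ?_ (pathHor_comp hX (X.δ 0 w) ?_ ?_ h').symm <;>
      exact face_face X (by decide) w
  comp_one := fun f g h h' => by
    obtain ⟨w, ⟨rfl, rfl⟩, -⟩ := fill_hor hX f g h
    rw [pathHor_comp hX w rfl rfl]
    refine (pathHsq_comp hX (X.σ 0 w) ?_ ?_ h').trans ?_ <;>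
      exact face_deg X (by decide) w
  interchange := fun a b c d hab hcd hac hbd h h' => by
    obtain ⟨x, ⟨rfl, rfl⟩, -⟩ := fill_hsq hX a b hab
    obtain ⟨y, ⟨rfl, rfl⟩, -⟩ := fill_hsq hX c d hcd
    have hxy : X.δ 0 x = X.δ 1 y := by
      apply ext_hor hX
      · exact ((face_face X (by decide) x).trans hbd).trans (face_face X (by decide) y)
      · exact ((face_face X (by decide) x).trans hac).trans (face_face X (by decide) y)
    obtain ⟨w, rfl, rfl⟩ := fill_vsq₃ hX x y hxy
    have e1 := pathHsq_comp hX (X.δ 2 w) rfl rfl hab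
    have e2 := pathHsq_comp hX (X.δ 0 w) rfl rfl hcd
    have e3 := pathVsq_comp hX (X.δ 5 w) (face_face X (by decide) w)
      (face_face X (by decide) w) hac
    have e4 := pathVsq_comp hX (X.δ 3 w) (face_face X (by decide) w)
      (face_face X (by decide) w) hbd
    refine (pathVsq_comp hX (X.δ 4 w) ?_ ?_ h).trans
      (Eq.trans ?_ (pathHsq_comp hX (X.δ 1 w) ?_ ?_ h').symm)
    · exact Eq.trans (face_face X (by decide) w) e1.symm
    · exact Eq.trans (face_face X (by decide) w) e2.symm
    · exact face_face X (by decide) w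
    · exact Eq.trans (face_face X (by decide) w) e3.symm
    · exact Eq.trans (face_face X (by decide) w) e4.symm

theorem pathDoubleCat_isStable (hX : IsTwoSegal X) : (pathDoubleCat hX).IsStable where
  span f v h := by
    obtain ⟨z, ⟨h1, h2⟩, hz⟩ := fill_hor hX v f (Eq.symm h)
    exact ⟨z, ⟨h2, h1⟩, fun z' h' => hz z' ⟨h'.2, h'.1⟩⟩
  cospan v f h := fill_ver hX v f h

theorem eq_of_degenerate_edge (hX : IsUnitalTwoSegal X) {n : ℕ} (i : Fin (n + 2))
    (y : X _⦋n + 2⦌) (z : X _⦋0⦌)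
    (h : X.σ 0 z = X.map (SimplexCategory.mkOfSucc i).op y) : ∃ w, X.σ i w = y := by
  obtain ⟨w, -, hw⟩ := Limits.Types.exists_of_isPullback (hX.unital n i) z y h
  exact ⟨w, hw⟩

theorem pathDoubleCat_isAugmented (hX : IsUnitalTwoSegal X) :
    (pathDoubleCat hX.twoSegal).IsAugmented (Set.range (X.σ (0 : Fin 1))) where
  hor x := by
    refine ⟨X.σ (0 : Fin 2) x, ⟨⟨X.δ (1 : Fin 2) x, ?_⟩, ?_⟩, ?_⟩
    · exact (face_deg X (by decide) x).symm
    · exact deg_face X (by decide) x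
    · rintro f ⟨⟨z, hz⟩, rfl⟩
      obtain ⟨w, rfl⟩ := eq_of_degenerate_edge hX (n := 0) 0 f z
        (hz.trans (congrArg (fun a => X.map (Quiver.Hom.op a) f) (by decide)))
      exact congrArg (X.σ 0) (deg_face X (by decide) w).symm
  ver x := by
    refine ⟨X.σ (1 : Fin 2) x, ⟨⟨X.δ (0 : Fin 2) x, ?_⟩, ?_⟩, ?_⟩
    · exact (face_deg X (by decide) x).symm
    · exact deg_face X (by decide) x
    · rintro f ⟨⟨z, hz⟩, rfl⟩
      obtain ⟨w, rfl⟩ := eq_of_degenerate_edge hX (n := 0) 1 f z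
        (hz.trans (congrArg (fun a => X.map (Quiver.Hom.op a) f) (by decide)))
      exact congrArg (X.σ 1) (deg_face X (by decide) w).symm

end Path

/-- The path construction of a unital 2-Segal set; the augmentation set is `X₀`, regarded as a subset
of `X₁` through the (injective) degeneracy map. -/
noncomputable def pathObj (X : SSet.{u}) (hX : IsUnitalTwoSegal X) : AugStDoubleCat.{u} where
  toDoubleCat := pathDoubleCat hX.twoSegal
  A := Set.range (X.σ (0 : Fin 1))
  stable := pathDoubleCat_isStable hX.twoSegal
  augmented := pathDoubleCat_isAugmented hX

theorem nat_face {X Y : SSet.{u}} (φ : X ⟶ Y) {n : ℕ} (i : Fin (n + 2)) (y : X _⦋n + 1⦌) :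
    Y.δ i (φ.app _ y) = φ.app _ (X.δ i y) :=
  (NatTrans.naturality_apply φ (SimplexCategory.δ i).op y).symm

theorem nat_deg {X Y : SSet.{u}} (φ : X ⟶ Y) {n : ℕ} (i : Fin (n + 1)) (y : X _⦋n⦌) :
    φ.app _ (X.σ i y) = Y.σ i (φ.app _ y) :=
  NatTrans.naturality_apply φ (SimplexCategory.σ i).op y

/-- The double functor induced by a simplicial map. -/
def pathMap {X Y : SSet.{u}} (hX : IsUnitalTwoSegal X) (hY : IsUnitalTwoSegal Y) (φ : X ⟶ Y) :
    AugDoubleFunctor (pathObj X hX) (pathObj Y hY) where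
  ob := φ.app (op ⦋1⦌)
  onHor := φ.app (op ⦋2⦌)
  onVer := φ.app (op ⦋2⦌)
  onSq := φ.app (op ⦋3⦌)
  hor :=
    { src := fun f => nat_face φ _ f
      tgt := fun f => nat_face φ _ f
      one := fun x => nat_deg φ _ x
      comp := fun f g h h' => by
        obtain ⟨z, ⟨rfl, rfl⟩, -⟩ := fill_hor hX.twoSegal f g h
        exact (congrArg _ (pathHor_comp hX.twoSegal z rfl rfl h)).trans
          ((nat_face φ _ z).symm.trans (pathHor_comp hY.twoSegal (φ.app _ z)
            (nat_face φ _ z) (nat_face φ _ z) h').symm) }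
  ver :=
    { src := fun f => nat_face φ _ f
      tgt := fun f => nat_face φ _ f
      one := fun x => nat_deg φ _ x
      comp := fun f g h h' => by
        obtain ⟨z, ⟨rfl, rfl⟩, -⟩ := fill_ver hX.twoSegal f g h
        exact (congrArg _ (pathVer_comp hX.twoSegal z rfl rfl h)).trans
          ((nat_face φ _ z).symm.trans (pathVer_comp hY.twoSegal (φ.app _ z)
            (nat_face φ _ z) (nat_face φ _ z) h').symm) }
  hsq :=
    { src := fun f => nat_face φ _ f
      tgt := fun f => nat_face φ _ f
      one := fun x => nat_deg φ _ x
      comp := fun f g h h' => by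
        obtain ⟨z, ⟨rfl, rfl⟩, -⟩ := fill_hsq hX.twoSegal f g h
        exact (congrArg _ (pathHsq_comp hX.twoSegal z rfl rfl h)).trans
          ((nat_face φ _ z).symm.trans (pathHsq_comp hY.twoSegal (φ.app _ z)
            (nat_face φ _ z) (nat_face φ _ z) h').symm) }
  vsq :=
    { src := fun f => nat_face φ _ f
      tgt := fun f => nat_face φ _ f
      one := fun x => nat_deg φ _ x
      comp := fun f g h h' => by
        obtain ⟨z, ⟨rfl, rfl⟩, -⟩ := fill_vsq hX.twoSegal f g h
        exact (congrArg _ (pathVsq_comp hX.twoSegal z rfl rfl h)).trans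
          ((nat_face φ _ z).symm.trans (pathVsq_comp hY.twoSegal (φ.app _ z)
            (nat_face φ _ z) (nat_face φ _ z) h').symm) }
  aug := by
    rintro _ ⟨z, rfl⟩
    exact ⟨φ.app _ z, (nat_deg φ _ z).symm⟩

/-- The property of being a unital 2-Segal set. -/
abbrev unitalTwoSegal : ObjectProperty SSet.{u} := IsUnitalTwoSegal

/-- The category of unital 2-Segal sets, a full subcategory of simplicial sets. -/
abbrev UnitalTwoSegalSet := unitalTwoSegal.{u}.FullSubcategory

/-- The path construction, a functor from unital 2-Segal sets to augmented stable double categories. -/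
noncomputable def pathConstruction : UnitalTwoSegalSet.{u} ⥤ AugStDoubleCat.{u} where
  obj X := pathObj X.obj X.property
  map {X Y} φ := pathMap X.property Y.property φ.hom

end Waldhausen

/-!
Because a square is determined by its top and left sides, and also by its right and bottom sides, a
double functor `W n → D` is determined by its first row, and the first row can be any chain of `n`
composable horizontal morphisms starting in the augmentation set. Gluing a triangle to a side of a
polygon amounts to factoring one morphism of this chain, and stability provides exactly one suitable
factorization. As every triangulated polygon arises by gluing such ears, `S_• D` is 2-Segal.

An `n`-simplex of a unital 2-Segal set `X` gives a double functor `W n → 𝒫 X`. The resulting map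
`X → S_• (𝒫 X)` is bijective in degrees at most two, hence in all degrees by the 2-Segal condition.
Restricting along `p` yields the first isomorphism, since `N^a = p^* S_•`.

For the second isomorphism it therefore suffices that a unital 2-Segal set `X` is the right Kan
extension of `p^* X`. A transformation `p^* Z → p^* X` assigns a simplex of `X` to every simplex of
`Z` together with a cut of its vertex set, naturally in order-preserving maps that respect the cuts.
A degenerate simplex has a cut between the two equal vertices, and also the cuts on either side of
them. Unitality of `X` forces the values at these cuts to be degenerate, which makes the value
independent of the cut, and hence natural in all maps.
-/

namespace Waldhausen

/-! ### Stable double categories -/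

theorem CatStr.comp_congr {O M : Type u} (C : CatStr O M) {f f' g g' : M} (hf : f = f')
    (hg : g = g') (h : C.tgt f = C.src g) (h' : C.tgt f' = C.src g') :
    C.comp f g h = C.comp f' g' h' := by
  subst hf hg
  rfl

namespace DoubleCat

variable {D : DoubleCat.{u}}

theorem hor_src_top (a : D.Sq) : D.hor.src (D.vsq.src a) = D.ver.src (D.hsq.src a) :=
  (D.src_functor.src a).symm

theorem hor_src_bottom (a : D.Sq) : D.hor.src (D.vsq.tgt a) = D.ver.tgt (D.hsq.src a) :=
  (D.src_functor.tgt a).symm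

theorem hor_tgt_top (a : D.Sq) : D.hor.tgt (D.vsq.src a) = D.ver.src (D.hsq.tgt a) :=
  (D.tgt_functor.src a).symm

theorem hor_tgt_bottom (a : D.Sq) : D.hor.tgt (D.vsq.tgt a) = D.ver.tgt (D.hsq.tgt a) :=
  (D.tgt_functor.tgt a).symm

theorem top_comp (a b : D.Sq) (h : D.hsq.tgt a = D.hsq.src b) :
    D.vsq.src (D.hsq.comp a b h) =
      D.hor.comp (D.vsq.src a) (D.vsq.src b) (by rw [hor_tgt_top, h, hor_src_top]) :=
  D.comp_src a b h _

theorem bottom_comp (a b : D.Sq) (h : D.hsq.tgt a = D.hsq.src b) :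
    D.vsq.tgt (D.hsq.comp a b h) =
      D.hor.comp (D.vsq.tgt a) (D.vsq.tgt b) (by rw [hor_tgt_bottom, h, hor_src_bottom]) :=
  D.comp_tgt a b h _

theorem left_comp (a b : D.Sq) (h : D.vsq.tgt a = D.vsq.src b) :
    D.hsq.src (D.vsq.comp a b h) =
      D.ver.comp (D.hsq.src a) (D.hsq.src b) (by rw [← hor_src_bottom, h, hor_src_top]) :=
  D.src_functor.comp a b h _

theorem right_comp (a b : D.Sq) (h : D.vsq.tgt a = D.vsq.src b) :
    D.hsq.tgt (D.vsq.comp a b h) =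
      D.ver.comp (D.hsq.tgt a) (D.hsq.tgt b) (by rw [← hor_tgt_bottom, h, hor_tgt_top]) :=
  D.tgt_functor.comp a b h _

namespace IsStable

/-- The square with given top and left sides in a stable double category. -/
noncomputable def fill (hD : D.IsStable) (f : D.Hor) (v : D.Ver) (h : D.hor.src f = D.ver.src v) :
    D.Sq :=
  (hD.span f v h).choose

theorem fill_top (hD : D.IsStable) {f : D.Hor} {v : D.Ver} (h : D.hor.src f = D.ver.src v) :
    D.vsq.src (hD.fill f v h) = f :=
  (hD.span f v h).choose_spec.1.1

theorem fill_left (hD : D.IsStable) {f : D.Hor} {v : D.Ver} (h : D.hor.src f = D.ver.src v) :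
    D.hsq.src (hD.fill f v h) = v :=
  (hD.span f v h).choose_spec.1.2

theorem ext_span (hD : D.IsStable) {a b : D.Sq} (h₁ : D.vsq.src a = D.vsq.src b)
    (h₂ : D.hsq.src a = D.hsq.src b) : a = b :=
  (hD.span _ _ (hor_src_top b)).unique ⟨h₁, h₂⟩ ⟨rfl, rfl⟩

theorem ext_cospan (hD : D.IsStable) {a b : D.Sq} (h₁ : D.hsq.tgt a = D.hsq.tgt b)
    (h₂ : D.vsq.tgt a = D.vsq.tgt b) : a = b :=
  (hD.cospan _ _ (hor_tgt_bottom b).symm).unique ⟨h₁, h₂⟩ ⟨rfl, rfl⟩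

theorem eq_comp_of_bottom_eq_comp (hD : D.IsStable) (q : D.Sq) {f g : D.Hor}
    (h : D.hor.tgt f = D.hor.src g) (hq : D.vsq.tgt q = D.hor.comp f g h) :
    ∃ (b a : D.Sq) (hba : D.hsq.tgt b = D.hsq.src a),
      D.vsq.tgt b = f ∧ D.vsq.tgt a = g ∧ q = D.hsq.comp b a hba := by
  obtain ⟨a, ⟨ha, rfl⟩, -⟩ :=
    hD.cospan (D.hsq.tgt q) g (by rw [← hor_tgt_bottom, hq, D.hor.tgt_comp])
  obtain ⟨b, ⟨hb, rfl⟩, -⟩ := hD.cospan (D.hsq.src a) f (by rw [h, hor_src_bottom])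
  refine ⟨b, a, hb, rfl, rfl, hD.ext_cospan ?_ ?_⟩
  · rw [D.hsq.tgt_comp, ha]
  · rw [hq, bottom_comp]

end IsStable

end DoubleCat

namespace AugStDoubleCat

variable {D : AugStDoubleCat.{u}}

variable (D) in
/-- The vertical morphism from `x` to the augmentation set. -/
noncomputable def augVer (x : D.Ob) : D.Ver := (D.augmented.ver x).choose

theorem src_augVer (x : D.Ob) : D.ver.src (D.augVer x) = x := (D.augmented.ver x).choose_spec.1.2

theorem tgt_augVer (x : D.Ob) : D.ver.tgt (D.augVer x) ∈ D.A := (D.augmented.ver x).choose_spec.1.1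

theorem eq_augVer {x : D.Ob} {v : D.Ver} (h₁ : D.ver.src v = x) (h₂ : D.ver.tgt v ∈ D.A) :
    v = D.augVer x :=
  (D.augmented.ver x).choose_spec.2 v ⟨h₂, h₁⟩

theorem augVer_of_mem {x : D.Ob} (h : x ∈ D.A) : D.augVer x = D.ver.one x :=
  (eq_augVer (D.ver.src_one x) (by rwa [D.ver.tgt_one])).symm

variable (D) in
/-- The horizontal morphism to `x` from the augmentation set. -/
noncomputable def augHor (x : D.Ob) : D.Hor := (D.augmented.hor x).choose

theorem eq_augHor {x : D.Ob} {f : D.Hor} (h₁ : D.hor.tgt f = x) (h₂ : D.hor.src f ∈ D.A) :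
    f = D.augHor x :=
  (D.augmented.hor x).choose_spec.2 f ⟨h₂, h₁⟩

theorem augHor_of_mem {x : D.Ob} (h : x ∈ D.A) : D.augHor x = D.hor.one x :=
  (eq_augHor (D.hor.tgt_one x) (by rwa [D.hor.src_one])).symm

end AugStDoubleCat

open DoubleCat AugStDoubleCat

/-! ### Chains of horizontal morphisms -/

/-- A functor from the ordered set `{j | i ≤ j}` to the category `C`: a row of a double functor
out of `W n`. -/
@[ext]
structure Chain {O M : Type u} (C : CatStr O M) {J : Type} [Preorder J] (i : J) where
  ob : ∀ j, i ≤ j → O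
  hor : ∀ j l, i ≤ j → j ≤ l → M
  src : ∀ j l hj hl, C.src (hor j l hj hl) = ob j hj
  tgt : ∀ j l hj hl, C.tgt (hor j l hj hl) = ob l (hj.trans hl)
  one : ∀ j hj, hor j j hj le_rfl = C.one (ob j hj)
  comp : ∀ j l m hj hl hm h,
    C.comp (hor j l hj hl) (hor l m (hj.trans hl) hm) h = hor j m hj (hl.trans hm)

namespace Chain

section Row

variable {D : AugStDoubleCat.{u}} {J : Type} [Preorder J] {i : J} (c : Chain D.hor i)
  {k m j l p : J} (hk : i ≤ k) (hkm : k ≤ m) (hkj : k ≤ j) (hmj : m ≤ j) (hjl : j ≤ l) (hlp : l ≤ p)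

/-- The square with top side `c.hor k j` and left side the augmentation morphism at `k`. -/
noncomputable def augSq : D.Sq :=
  D.stable.fill (c.hor k j hk hkj) (D.augVer (c.ob k hk)) (by rw [c.src, src_augVer])

theorem augSq_top : D.vsq.src (c.augSq hk hkj) = c.hor k j hk hkj := D.stable.fill_top _

theorem augSq_left : D.hsq.src (c.augSq hk hkj) = D.augVer (c.ob k hk) := D.stable.fill_left _

/-- The vertical morphism from row `i` to row `k` in column `j`. -/
noncomputable def ver : D.Ver := D.hsq.tgt (c.augSq hk hkj)

theorem augSq_right : D.hsq.tgt (c.augSq hk hkj) = c.ver hk hkj := rfl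

theorem src_ver : D.ver.src (c.ver hk hkj) = c.ob j (hk.trans hkj) := by
  rw [← augSq_right, ← hor_tgt_top, augSq_top, c.tgt]

/-- The square between rows `i` and `k` and columns `j` and `l`. -/
noncomputable def sq : D.Sq :=
  D.stable.fill (c.hor j l (hk.trans hkj) hjl) (c.ver hk hkj) (by rw [c.src, c.src_ver])

theorem sq_top : D.vsq.src (c.sq hk hkj hjl) = c.hor j l (hk.trans hkj) hjl := D.stable.fill_top _

theorem sq_left : D.hsq.src (c.sq hk hkj hjl) = c.ver hk hkj := D.stable.fill_left _

theorem augSq_comp_sq :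
    D.hsq.comp (c.augSq hk hkj) (c.sq hk hkj hjl) (by rw [augSq_right, sq_left]) =
      c.augSq hk (hkj.trans hjl) := by
  apply D.stable.ext_span
  · simp only [top_comp, augSq_top, sq_top, c.comp]
  · simp only [D.hsq.src_comp, augSq_left]

theorem sq_right : D.hsq.tgt (c.sq hk hkj hjl) = c.ver hk (hkj.trans hjl) := by
  rw [← augSq_right, ← c.augSq_comp_sq hk hkj hjl, D.hsq.tgt_comp]

theorem sq_self : c.sq hk hkj le_rfl = D.hsq.one (c.ver hk hkj) := by
  apply D.stable.ext_span
  · rw [sq_top, D.one_functor.src, c.one, c.src_ver]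
  · rw [sq_left, D.hsq.src_one]

theorem sq_comp (h) :
    D.hsq.comp (c.sq hk hkj hjl) (c.sq hk (hkj.trans hjl) hlp) h = c.sq hk hkj (hjl.trans hlp) := by
  apply D.stable.ext_span
  · simp only [top_comp, sq_top, c.comp]
  · simp only [D.hsq.src_comp, sq_left]

/-- The row `k` of the double functor whose row `i` is `c`. -/
noncomputable def row : Chain D.hor k where
  ob j hj := D.ver.tgt (c.ver hk hj)
  hor j l hj hl := D.vsq.tgt (c.sq hk hj hl)
  src j l hj hl := by rw [hor_src_bottom, sq_left]
  tgt j l hj hl := by rw [hor_tgt_bottom, sq_right]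
  one j hj := by rw [sq_self, D.one_functor.tgt]
  comp j l m hj hl hm h := by
    rw [← c.sq_comp hk hj hl hm (by rw [sq_right, sq_left]), bottom_comp]

theorem row_ob : (c.row hk).ob j hkj = D.ver.tgt (c.ver hk hkj) := rfl

theorem row_hor : (c.row hk).hor j l hkj hjl = D.vsq.tgt (c.sq hk hkj hjl) := rfl

theorem ver_self : c.ver hk le_rfl = D.augVer (c.ob k hk) := by
  have h : c.augSq hk le_rfl = D.hsq.one (D.augVer (c.ob k hk)) := by
    apply D.stable.ext_span
    · rw [augSq_top, D.one_functor.src, src_augVer, c.one]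
    · rw [augSq_left, D.hsq.src_one]
  rw [← augSq_right, h, D.hsq.tgt_one]

theorem row_ob_self_mem : (c.row hk).ob k le_rfl ∈ D.A := by
  rw [row_ob, ver_self]
  exact tgt_augVer _

variable {c} in
theorem ver_first (hc : c.ob i le_rfl ∈ D.A) (hj : i ≤ j) :
    c.ver le_rfl hj = D.ver.one (c.ob j hj) := by
  have h : c.augSq le_rfl hj = D.vsq.one (c.hor i j le_rfl hj) := by
    apply D.stable.ext_span
    · rw [augSq_top, D.vsq.src_one]
    · rw [augSq_left, D.src_functor.one, augVer_of_mem hc, c.src]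
  rw [← augSq_right, h, D.tgt_functor.one, c.tgt]

variable {c} in
theorem sq_first (hc : c.ob i le_rfl ∈ D.A) (hj : i ≤ j) :
    c.sq le_rfl hj hjl = D.vsq.one (c.hor j l hj hjl) := by
  apply D.stable.ext_span
  · rw [sq_top, D.vsq.src_one]
  · rw [sq_left, D.src_functor.one, ver_first hc, c.src]

variable {c} in
theorem row_first (hc : c.ob i le_rfl ∈ D.A) : c.row le_rfl = c := by
  ext j
  · rw [row_ob, ver_first hc, D.ver.tgt_one]
  · rw [row_hor, sq_first _ hc, D.vsq.tgt_one]

theorem ver_comp (h) :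
    D.ver.comp (c.ver hk (hkm.trans hmj)) ((c.row hk).ver hkm hmj) h =
      c.ver (hk.trans hkm) hmj := by
  have hcomp : D.vsq.comp (c.sq hk hkm hmj) ((c.row hk).augSq hkm hmj)
      (by rw [augSq_top, row_hor]) = c.augSq (hk.trans hkm) hmj := by
    apply D.stable.ext_span
    · rw [D.vsq.src_comp, sq_top, augSq_top]
    · rw [augSq_left, left_comp]
      apply eq_augVer
      · rw [D.ver.src_comp, sq_left, src_ver]
      · rw [D.ver.tgt_comp, augSq_left]
        exact tgt_augVer _
  simp only [← augSq_right c (hk.trans hkm) hmj, ← hcomp, right_comp, sq_right, augSq_right]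

theorem sq_vcomp (h) :
    D.vsq.comp (c.sq hk (hkm.trans hmj) hjl) ((c.row hk).sq hkm hmj hjl) h =
      c.sq (hk.trans hkm) hmj hjl := by
  apply D.stable.ext_span
  · rw [D.vsq.src_comp, sq_top, sq_top]
  · simp only [left_comp, sq_left, ver_comp]

theorem row_row : (c.row hk).row hkm = c.row (hk.trans hkm) := by
  ext j
  · rw [row_ob, row_ob, ← c.ver_comp hk hkm _ (by rw [src_ver, row_ob]), D.ver.tgt_comp]
  · rw [row_hor, row_hor, ← c.sq_vcomp hk hkm _ _ (by rw [sq_top, row_hor]), D.vsq.tgt_comp]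

end Row

/-- The composite of `d` consecutive morphisms of a sequence, starting with the `j`-th one. -/
def seqComp {O M : Type u} (C : CatStr O M) (f : ℕ → M) (hf : ∀ j, C.tgt (f j) = C.src (f (j + 1)))
    (j d : ℕ) : {g : M // C.src g = C.src (f j) ∧ C.tgt g = C.src (f (j + d))} :=
  match d with
  | 0 => ⟨C.one (C.src (f j)), C.src_one _, C.tgt_one _⟩
  | d + 1 =>
    have g := seqComp C f hf j d
    ⟨C.comp g.1 (f (j + d)) g.2.2, (C.src_comp _ _ _).trans g.2.1, (C.tgt_comp _ _ _).trans (hf _)⟩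

section OfSeq

variable {O M : Type u} (C : CatStr O M) (f : ℕ → M) (hf : ∀ j, C.tgt (f j) = C.src (f (j + 1)))

theorem seqComp_comp (j l d e : ℕ) (hl : l = j + d) (h) :
    C.comp (seqComp C f hf j d).1 (seqComp C f hf l e).1 h = (seqComp C f hf j (d + e)).1 := by
  subst hl
  induction e with
  | zero =>
    refine (C.comp_congr rfl ?_ _ (C.src_one _).symm).trans (C.comp_one _)
    exact congrArg C.one (seqComp C f hf j d).2.2.symm
  | succ e ih =>
    have h' := (seqComp C f hf j d).2.2.trans (seqComp C f hf (j + d) e).2.1.symm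
    exact (C.assoc _ _ _ h' (seqComp C f hf (j + d) e).2.2).symm.trans
      (C.comp_congr (ih h') (congrArg f (Nat.add_assoc j d e)) _ _)

/-- The chain of composites of a sequence of composable morphisms. -/
def ofSeq (n : ℕ) : Chain C (0 : Fin (n + 1)) where
  ob j _ := C.src (f j)
  hor j l _ _ := (seqComp C f hf j (l - j)).1
  src j l _ _ := (seqComp C f hf j (l - j)).2.1
  tgt j l _ h := by rw [(seqComp C f hf j (l - j)).2.2, Nat.add_sub_cancel' h]
  one j _ := by rw [Nat.sub_self]; rfl
  comp j l m _ hl hm h := by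
    rw [Fin.le_def] at hl hm
    rw [seqComp_comp C f hf j l _ _ (by omega) h, show l.val - j + (m - l) = m - j by omega]

theorem ofSeq_hor_succ (n : ℕ) (j l : Fin (n + 1)) (hl : l.val = j.val + 1) (h) (h') :
    (ofSeq C f hf n).hor j l h h' = f j := by
  change (seqComp C f hf j (l.val - j)).1 = _
  rw [show l.val - j.val = 0 + 1 by omega]
  exact C.one_comp (f j)

end OfSeq

end Chain


/-! ### Double functors out of `W n` -/

section IsFunctor

variable {n : ℕ} {O M : Type u} {C : CatStr O M}

theorem isFunctor_wHor {F₀ : WOb n → O} {F₁ : WHor n → M}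
    (src : ∀ f, C.src (F₁ f) = F₀ ((wHor n).src f)) (tgt : ∀ f, C.tgt (F₁ f) = F₀ ((wHor n).tgt f))
    (one : ∀ x, F₁ ((wHor n).one x) = C.one (F₀ x))
    (comp : ∀ i j l m hij hjl hlm h, C.comp (F₁ ⟨i, j, l, hij, hjl⟩)
      (F₁ ⟨i, l, m, hij.trans hjl, hlm⟩) h = F₁ ⟨i, j, m, hij, hjl.trans hlm⟩) :
    (wHor n).IsFunctor C F₀ F₁ where
  src := src
  tgt := tgt
  one := one
  comp := by
    rintro ⟨i, j, l, hij, hjl⟩ ⟨i', j', l', hij', hjl'⟩ h h'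
    obtain ⟨rfl, rfl⟩ := WOb.mk.inj h
    exact (comp i j l l' hij hjl hjl' h').symm

theorem isFunctor_wVer {F₀ : WOb n → O} {F₁ : WVer n → M}
    (src : ∀ f, C.src (F₁ f) = F₀ ((wVer n).src f)) (tgt : ∀ f, C.tgt (F₁ f) = F₀ ((wVer n).tgt f))
    (one : ∀ x, F₁ ((wVer n).one x) = C.one (F₀ x))
    (comp : ∀ i k m j hik hkm hmj h, C.comp (F₁ ⟨i, k, j, hik, hkm.trans hmj⟩)
      (F₁ ⟨k, m, j, hkm, hmj⟩) h = F₁ ⟨i, m, j, hik.trans hkm, hmj⟩) :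
    (wVer n).IsFunctor C F₀ F₁ where
  src := src
  tgt := tgt
  one := one
  comp := by
    rintro ⟨i, k, j, hik, hkj⟩ ⟨i', k', j', hik', hkj'⟩ h h'
    obtain ⟨rfl, rfl⟩ := WOb.mk.inj h
    exact (comp i k k' j hik hik' hkj' h').symm

theorem isFunctor_wHsq {F₀ : WVer n → O} {F₁ : WSq n → M}
    (src : ∀ a, C.src (F₁ a) = F₀ ((wHsq n).src a)) (tgt : ∀ a, C.tgt (F₁ a) = F₀ ((wHsq n).tgt a))
    (one : ∀ v, F₁ ((wHsq n).one v) = C.one (F₀ v))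
    (comp : ∀ i k j l m hik hkj hjl hlm h, C.comp (F₁ ⟨i, k, j, l, hik, hkj, hjl⟩)
      (F₁ ⟨i, k, l, m, hik, hkj.trans hjl, hlm⟩) h = F₁ ⟨i, k, j, m, hik, hkj, hjl.trans hlm⟩) :
    (wHsq n).IsFunctor C F₀ F₁ where
  src := src
  tgt := tgt
  one := one
  comp := by
    rintro ⟨i, k, j, l, hik, hkj, hjl⟩ ⟨i', k', j', l', hik', hkj', hjl'⟩ h h'
    obtain ⟨rfl, rfl, rfl⟩ := WVer.mk.inj h
    exact (comp i k j l l' hik hkj hjl hjl' h').symm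

theorem isFunctor_wVsq {F₀ : WHor n → O} {F₁ : WSq n → M}
    (src : ∀ a, C.src (F₁ a) = F₀ ((wVsq n).src a)) (tgt : ∀ a, C.tgt (F₁ a) = F₀ ((wVsq n).tgt a))
    (one : ∀ f, F₁ ((wVsq n).one f) = C.one (F₀ f))
    (comp : ∀ i k m j l hik hkm hmj hjl h, C.comp (F₁ ⟨i, k, j, l, hik, hkm.trans hmj, hjl⟩)
      (F₁ ⟨k, m, j, l, hkm, hmj, hjl⟩) h = F₁ ⟨i, m, j, l, hik.trans hkm, hmj, hjl⟩) :
    (wVsq n).IsFunctor C F₀ F₁ where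
  src := src
  tgt := tgt
  one := one
  comp := by
    rintro ⟨i, k, j, l, hik, hkj, hjl⟩ ⟨i', k', j', l', hik', hkj', hjl'⟩ h h'
    obtain ⟨rfl, rfl, rfl⟩ := WHor.mk.inj h
    exact (comp i k k' j l hik hik' hkj' hjl' h').symm

end IsFunctor

namespace AugDoubleFunctor

section Values

variable {D : AugStDoubleCat.{u}} {n : ℕ} (F : AugDoubleFunctor (W n) D)

/-- The value at the object `(i, j)`. -/
def wOb (i j : Fin (n + 1)) (hij : i ≤ j) : D.Ob := F.ob ⟨i, j, hij⟩

/-- The value at the horizontal morphism `(i, j, l)`. -/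
def wHor (i j l : Fin (n + 1)) (hij : i ≤ j) (hjl : j ≤ l) : D.Hor := F.onHor ⟨i, j, l, hij, hjl⟩

/-- The value at the vertical morphism `(i, k, j)`. -/
def wVer (i k j : Fin (n + 1)) (hik : i ≤ k) (hkj : k ≤ j) : D.Ver := F.onVer ⟨i, k, j, hik, hkj⟩

/-- The value at the square `(i, k, j, l)`. -/
def wSq (i k j l : Fin (n + 1)) (hik : i ≤ k) (hkj : k ≤ j) (hjl : j ≤ l) : D.Sq :=
  F.onSq ⟨i, k, j, l, hik, hkj, hjl⟩

variable (i k j l m : Fin (n + 1)) (hik : i ≤ k) (hij : i ≤ j) (hkj : k ≤ j) (hjl : j ≤ l)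
  (hlm : l ≤ m)

theorem src_wHor : D.hor.src (F.wHor i j l hij hjl) = F.wOb i j hij := F.hor.src _

theorem tgt_wHor : D.hor.tgt (F.wHor i j l hij hjl) = F.wOb i l (hij.trans hjl) := F.hor.tgt _

theorem wHor_one : F.wHor i j j hij le_rfl = D.hor.one (F.wOb i j hij) := F.hor.one ⟨i, j, hij⟩

theorem wHor_comp (h) :
    D.hor.comp (F.wHor i j l hij hjl) (F.wHor i l m (hij.trans hjl) hlm) h =
      F.wHor i j m hij (hjl.trans hlm) :=
  (F.hor.comp ⟨i, j, l, hij, hjl⟩ ⟨i, l, m, hij.trans hjl, hlm⟩ rfl h).symm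

theorem src_wVer : D.ver.src (F.wVer i k j hik hkj) = F.wOb i j (hik.trans hkj) := F.ver.src _

theorem tgt_wVer : D.ver.tgt (F.wVer i k j hik hkj) = F.wOb k j hkj := F.ver.tgt _

theorem wSq_top : D.vsq.src (F.wSq i k j l hik hkj hjl) = F.wHor i j l (hik.trans hkj) hjl :=
  F.vsq.src _

theorem wSq_bottom : D.vsq.tgt (F.wSq i k j l hik hkj hjl) = F.wHor k j l hkj hjl := F.vsq.tgt _

theorem wSq_left : D.hsq.src (F.wSq i k j l hik hkj hjl) = F.wVer i k j hik hkj := F.hsq.src _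

theorem wSq_right : D.hsq.tgt (F.wSq i k j l hik hkj hjl) = F.wVer i k l hik (hkj.trans hjl) :=
  F.hsq.tgt _

theorem wOb_self_mem : F.wOb i i le_rfl ∈ D.A := F.aug ⟨i, i, le_rfl⟩ rfl

theorem wVer_aug : F.wVer i j j hij le_rfl = D.augVer (F.wOb i j hij) :=
  eq_augVer (F.src_wVer ..) (by rw [F.tgt_wVer]; exact F.wOb_self_mem _)

theorem wHor_aug : F.wHor i i j le_rfl hij = D.augHor (F.wOb i j hij) :=
  eq_augHor (F.tgt_wHor ..) (by rw [F.src_wHor]; exact F.wOb_self_mem _)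

theorem wHor_congr {i j l i' j' l' : Fin (n + 1)} (hij : i ≤ j) (hjl : j ≤ l) (hi : i = i')
    (hj : j = j') (hl : l = l') :
    F.wHor i j l hij hjl = F.wHor i' j' l' (hi ▸ hj ▸ hij) (hj ▸ hl ▸ hjl) := by
  subst hi hj hl
  rfl

theorem wOb_congr {i j i' j' : Fin (n + 1)} (hij : i ≤ j) (hi : i = i') (hj : j = j') :
    F.wOb i j hij = F.wOb i' j' (hi ▸ hj ▸ hij) := by
  subst hi hj
  rfl

end Values

section Ext

variable {D : AugStDoubleCat.{u}} {n : ℕ} {F F' : AugDoubleFunctor (W n) D}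

/- The square `(i, k, k, l)` has right side `(i, k, l)`, and it is determined by its top side, in
row `i`, and its left side, an augmentation morphism. -/
theorem wVer_eq_of_wHor {i : Fin (n + 1)}
    (h : ∀ j l hj hl, F.wHor i j l hj hl = F'.wHor i j l hj hl) (k l : Fin (n + 1)) (hik : i ≤ k)
    (hkl : k ≤ l) : F.wVer i k l hik hkl = F'.wVer i k l hik hkl := by
  have hsq : F.wSq i k k l hik le_rfl hkl = F'.wSq i k k l hik le_rfl hkl := by
    apply D.stable.ext_span
    · rw [wSq_top, wSq_top, h]
    · rw [wSq_left, wSq_left, wVer_aug, wVer_aug, ← F.src_wHor i k l hik hkl, h, src_wHor]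
  rw [← F.wSq_right i k k l hik le_rfl hkl, hsq, wSq_right]

theorem wSq_eq_of_wHor {i : Fin (n + 1)}
    (h : ∀ j l hj hl, F.wHor i j l hj hl = F'.wHor i j l hj hl) (k j l : Fin (n + 1)) (hik : i ≤ k)
    (hkj : k ≤ j) (hjl : j ≤ l) : F.wSq i k j l hik hkj hjl = F'.wSq i k j l hik hkj hjl := by
  apply D.stable.ext_span
  · rw [wSq_top, wSq_top, h]
  · rw [wSq_left, wSq_left, wVer_eq_of_wHor h]

theorem ext_wHor_zero
    (h : ∀ j l hj hl, F.wHor 0 j l hj hl = F'.wHor 0 j l hj hl) : F = F' := by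
  have hrow : ∀ i j l hij hjl, F.wHor i j l hij hjl = F'.wHor i j l hij hjl := by
    intro i j l hij hjl
    rw [← F.wSq_bottom 0 i j l (Fin.zero_le _), wSq_eq_of_wHor h, wSq_bottom]
  apply AugDoubleFunctor.ext
  · exact funext fun x => by
      change F.wOb x.i x.j x.hij = F'.wOb x.i x.j x.hij
      rw [← F.src_wHor x.i x.j x.j x.hij le_rfl, hrow, src_wHor]
  · exact funext fun _ => hrow ..
  · exact funext fun _ => wVer_eq_of_wHor (hrow _) ..
  · exact funext fun _ => wSq_eq_of_wHor (hrow _) ..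

theorem ext_wHor_succ (h₀ : F.wOb 0 0 le_rfl = F'.wOb 0 0 le_rfl)
    (h : ∀ j l hj hl, l.val = j.val + 1 → F.wHor 0 j l hj hl = F'.wHor 0 j l hj hl) : F = F' := by
  have hob : ∀ j, F.wOb 0 j (Fin.zero_le _) = F'.wOb 0 j (Fin.zero_le _) := by
    intro j
    by_cases hj : j = 0
    · subst hj
      exact h₀
    · have hj₀ : j.val ≠ 0 := fun e => hj (Fin.ext e)
      let i : Fin (n + 1) := ⟨j.val - 1, by omega⟩
      have hij : i ≤ j := Nat.sub_le _ _
      rw [← F.tgt_wHor 0 i j (Fin.zero_le _) hij, h i j _ _ (by simp only [i]; omega), tgt_wHor]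
  apply ext_wHor_zero
  intro j l hj hl
  obtain ⟨d, hd⟩ := Nat.exists_eq_add_of_le (Fin.le_def.1 hl)
  induction d generalizing l with
  | zero =>
    obtain rfl : l = j := Fin.ext hd
    rw [wHor_one, wHor_one, hob]
  | succ d ih =>
    let k : Fin (n + 1) := ⟨j.val + d, by omega⟩
    have hjk : j ≤ k := Nat.le_add_right _ _
    have hkl : k ≤ l := by rw [Fin.le_def]; simp only [k]; omega
    rw [← F.wHor_comp 0 j k l hj hjk hkl (by rw [tgt_wHor, src_wHor]),
      ← F'.wHor_comp 0 j k l hj hjk hkl (by rw [tgt_wHor, src_wHor])]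
    exact D.hor.comp_congr (ih k hjk rfl) (h k l _ hkl (by simp only [k]; omega)) _ _

theorem ext_of_wOb_one {F F' : AugDoubleFunctor (W (n + 1)) D}
    (h₁ : F.wOb 0 1 (Fin.zero_le _) = F'.wOb 0 1 (Fin.zero_le _))
    (h : ∀ j l hj hl, 1 ≤ j.val → l.val = j.val + 1 → F.wHor 0 j l hj hl = F'.wHor 0 j l hj hl) :
    F = F' := by
  have h01 : F.wHor 0 0 1 le_rfl (Fin.zero_le _) = F'.wHor 0 0 1 le_rfl (Fin.zero_le _) := by
    rw [wHor_aug, wHor_aug, h₁]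
  apply ext_wHor_succ
  · rw [← F.src_wHor 0 0 1 le_rfl (Fin.zero_le _), h01, src_wHor]
  · intro j l hj hl hjl
    by_cases h0 : j.val = 0
    · obtain rfl : j = 0 := Fin.ext h0
      obtain rfl : l = 1 := Fin.ext hjl
      exact h01
    · exact h j l hj hl (by omega) hjl

theorem ext_zero {F F' : AugDoubleFunctor (W 0) D} (h : F.wOb 0 0 le_rfl = F'.wOb 0 0 le_rfl) :
    F = F' :=
  ext_wHor_succ h fun j l _ _ hjl => by omega

theorem ext_one {F F' : AugDoubleFunctor (W 1) D}
    (h : F.wOb 0 1 (Fin.zero_le _) = F'.wOb 0 1 (Fin.zero_le _)) : F = F' :=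
  ext_of_wOb_one h fun j l _ _ hj hjl => by omega

theorem ext_two {F F' : AugDoubleFunctor (W 2) D}
    (h : F.wHor 0 1 2 (Fin.zero_le _) (by decide) = F'.wHor 0 1 2 (Fin.zero_le _) (by decide)) :
    F = F' := by
  apply ext_of_wOb_one
  · rw [← F.src_wHor 0 1 2 (Fin.zero_le _) (by decide), h, src_wHor]
  · intro j l hj hl hj1 hjl
    obtain rfl : j = 1 := Fin.ext (by rw [Fin.val_one]; omega)
    obtain rfl : l = 2 := Fin.ext hjl
    exact h

end Ext

section Existence

variable {D : AugStDoubleCat.{u}} {n : ℕ}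

/-- The double functor from `W n` whose row `i` is `c.row i`. -/
noncomputable def ofChain (c : Chain D.hor (0 : Fin (n + 1))) : AugDoubleFunctor (W n) D where
  ob x := (c.row (Fin.zero_le x.i)).ob x.j x.hij
  onHor f := (c.row (Fin.zero_le f.i)).hor f.j f.l f.hij f.hjl
  onVer v := (c.row (Fin.zero_le v.i)).ver v.hik v.hkj
  onSq a := (c.row (Fin.zero_le a.i)).sq a.hik a.hkj a.hjl
  hor := isFunctor_wHor (fun _ => Chain.src ..) (fun _ => Chain.tgt ..) (fun _ => Chain.one ..)
    (fun _ _ _ _ _ _ _ _ => Chain.comp ..)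
  ver := isFunctor_wVer (fun _ => Chain.src_ver ..)
    (fun v => by rw [← Chain.row_ob, Chain.row_row]; rfl)
    (fun _ => Chain.ver_first (c.row_ob_self_mem _) _)
    (fun i k m j hik hkm hmj h => by
      simp only [← c.row_row (Fin.zero_le i) hik, Chain.ver_comp])
  hsq := isFunctor_wHsq (fun _ => Chain.sq_left ..) (fun _ => Chain.sq_right ..)
    (fun _ => Chain.sq_self ..) (fun _ _ _ _ _ _ _ _ _ _ => Chain.sq_comp ..)
  vsq := isFunctor_wVsq (fun _ => Chain.sq_top ..)
    (fun a => by rw [← Chain.row_hor, Chain.row_row]; rfl)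
    (fun _ => Chain.sq_first _ (c.row_ob_self_mem _) _)
    (fun i k m j l hik hkm hmj hjl h => by
      simp only [← c.row_row (Fin.zero_le i) hik, Chain.sq_vcomp])
  aug := by
    rintro ⟨i, j, hij⟩ h
    obtain rfl : i = j := h
    exact c.row_ob_self_mem _

theorem exists_wHor_eq (n : ℕ) (f : ℕ → D.Hor) (hf : ∀ j, D.hor.tgt (f j) = D.hor.src (f (j + 1)))
    (h₀ : D.hor.src (f 0) ∈ D.A) : ∃ F : AugDoubleFunctor (W n) D,
      (∀ j h, F.wOb 0 j h = D.hor.src (f j)) ∧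
        ∀ j l hj hl, l.val = j.val + 1 → F.wHor 0 j l hj hl = f j := by
  have hrow : (Chain.ofSeq D.hor f hf n).row le_rfl = Chain.ofSeq D.hor f hf n :=
    Chain.row_first h₀
  refine ⟨ofChain (Chain.ofSeq D.hor f hf n), fun j h => ?_, fun j l hj hl h => ?_⟩
  · exact congrArg (fun c => c.ob j h) hrow
  · exact (congrArg (fun c => c.hor j l hj hl) hrow).trans (Chain.ofSeq_hor_succ _ _ _ _ _ _ h _ _)

end Existence

end AugDoubleFunctor

open AugDoubleFunctor


/-! ### Polygon triangulations -/

namespace IsPolygonTriangulation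

section

variable {n : ℕ} {E : Fin (n + 1) → Fin (n + 1) → Prop}

theorem side (hE : IsPolygonTriangulation E) (k : Fin n) : E k.castSucc k.succ := by
  refine hE.maximal _ _ Fin.castSucc_lt_succ fun p q _ => ?_
  simp only [Fin.lt_def, Fin.val_castSucc, Fin.val_succ]
  omega

theorem zero_last (hE : IsPolygonTriangulation E) (hn : 0 < n) : E 0 (Fin.last n) := by
  refine hE.maximal _ _ hn fun p q _ => ?_
  simp only [Fin.lt_def, Fin.val_last, Fin.val_zero]
  omega

theorem exists_apex (hE : IsPolygonTriangulation E) {i j : Fin (n + 1)} (h : E i j)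
    (hij : i.val + 2 ≤ j.val) : ∃ k, E i k ∧ E k j := by
  have hside : i < ⟨i.val + 1, by omega⟩ ∧ ⟨i.val + 1, by omega⟩ < j ∧
      E i ⟨i.val + 1, by omega⟩ :=
    ⟨Nat.lt_succ_self _, hij, hE.side ⟨i.val, by omega⟩⟩
  obtain ⟨k, ⟨hik, hkj, hk⟩, hmax⟩ :=
    (Set.toFinite {k | i < k ∧ k < j ∧ E i k}).exists_maximal ⟨_, hside⟩
  refine ⟨k, hk, hE.maximal _ _ hkj fun p q hpq => ⟨fun hc => ?_, fun hc => ?_⟩⟩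
  · exact hE.noncrossing _ _ _ _ h hpq ⟨hik.trans hc.1, hc.2⟩
  · rcases lt_trichotomy p i with hp | rfl | hp
    · exact hE.noncrossing _ _ _ _ hpq h ⟨hp, hik.trans hc.2.1, hc.2.2⟩
    · exact hc.2.1.not_ge (hmax ⟨hik.trans hc.2.1, hc.2.2, hpq⟩ hc.2.1.le)
    · exact hE.noncrossing _ _ _ _ hk hpq ⟨hp, hc.1, hc.2.1⟩

/-- The triangle of a triangulation with the given sides. -/
def triangle (hE : IsPolygonTriangulation E) {i j k : Fin (n + 1)} (hij : E i j) (hjk : E j k)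
    (hik : E i k) : PolygonTriangle E :=
  ⟨SimplexCategory.mkOfLeComp i j k (hE.lt _ _ hij).le (hE.lt _ _ hjk).le, hij, hjk, hik⟩

theorem exists_triangle_of_side_of_le (hE : IsPolygonTriangulation E) (a : Fin n)
    {i j : Fin (n + 1)} (h : E i j) (hij : i.val + 2 ≤ j.val) (hi : i ≤ a.castSucc)
    (hj : a.succ ≤ j) :
    ∃ (t : PolygonTriangle E) (s : Fin 3), SimplexCategory.δ s ≫ t.1 =
      SimplexCategory.mkOfSucc a := by
  induction hd : j.val - i.val using Nat.strong_induction_on generalizing i j with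
  | _ d ih =>
    obtain ⟨k, hik, hkj⟩ := hE.exists_apex h hij
    have hik' := hE.lt _ _ hik
    have hkj' := hE.lt _ _ hkj
    simp only [Fin.lt_def, Fin.le_def, Fin.val_castSucc, Fin.val_succ] at hik' hkj' hi hj
    by_cases hak : a.val + 1 ≤ k.val
    · by_cases hlong : i.val + 2 ≤ k.val
      · exact ih _ (by omega) hik hlong hi hak rfl
      · obtain rfl : i = a.castSucc := Fin.ext (by simp only [Fin.val_castSucc]; omega)
        obtain rfl : k = a.succ :=
          Fin.ext (by simp only [Fin.val_castSucc, Fin.val_succ] at *; omega)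
        exact ⟨hE.triangle hik hkj h, 2, by ext x; fin_cases x <;> rfl⟩
    · by_cases hlong : k.val + 2 ≤ j.val
      · exact ih _ (by omega) hkj hlong (Nat.le_of_not_lt hak) hj rfl
      · obtain rfl : k = a.castSucc := Fin.ext (by simp only [Fin.val_castSucc]; omega)
        obtain rfl : j = a.succ :=
          Fin.ext (by simp only [Fin.val_castSucc, Fin.val_succ] at *; omega)
        exact ⟨hE.triangle hik hkj h, 0, by ext x; fin_cases x <;> rfl⟩

theorem exists_triangle_of_side (hE : IsPolygonTriangulation E) (hn : 2 ≤ n) (a : Fin n) :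
    ∃ (t : PolygonTriangle E) (s : Fin 3), SimplexCategory.δ s ≫ t.1 =
      SimplexCategory.mkOfSucc a :=
  hE.exists_triangle_of_side_of_le a (hE.zero_last (by omega)) (by simpa using hn)
    (Fin.zero_le _) (Fin.le_last _)

end

theorem exists_ear_of_le {n : ℕ} {E : Fin (n + 3) → Fin (n + 3) → Prop}
    (hE : IsPolygonTriangulation (n := n + 2) E) {i j : Fin (n + 3)} (h : E i j)
    (hij : i.val + 2 ≤ j.val) : ∃ k : Fin (n + 1), E k.castSucc.castSucc k.succ.succ := by
  induction hd : j.val - i.val using Nat.strong_induction_on generalizing i j with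
  | _ d ih =>
    by_cases hij' : j.val = i.val + 2
    · obtain ⟨j, hj⟩ := j
      obtain rfl : j = i.val + 2 := hij'
      exact ⟨⟨i.val, by omega⟩, h⟩
    · obtain ⟨k, hik, hkj⟩ := hE.exists_apex h hij
      have hik' : i.val < k.val := hE.lt _ _ hik
      have hkj' : k.val < j.val := hE.lt _ _ hkj
      by_cases hk : i.val + 2 ≤ k.val
      · exact ih _ (by omega) hik hk rfl
      · exact ih _ (by omega) hkj (by omega) rfl

theorem exists_ear {n : ℕ} {E : Fin (n + 3) → Fin (n + 3) → Prop}
    (hE : IsPolygonTriangulation (n := n + 2) E) :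
    ∃ k : Fin (n + 1), E k.castSucc.castSucc k.succ.succ :=
  hE.exists_ear_of_le (hE.zero_last (by omega)) (by simp)

section

variable {m : ℕ} {E : Fin (m + 4) → Fin (m + 4) → Prop} {k : Fin (m + 2)}

theorem val_eq_of_ear (hE : IsPolygonTriangulation (n := m + 3) E)
    (h : E k.castSucc.castSucc k.succ.succ) {i j : Fin (m + 4)} (hij : E i j) :
    (i.val = k.val + 1 → j.val = k.val + 2) ∧ (j.val = k.val + 1 → i.val = k.val) := by
  have h₀ := hE.lt _ _ hij
  have h₁ := hE.noncrossing _ _ _ _ h hij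
  have h₂ := hE.noncrossing _ _ _ _ hij h
  simp only [Fin.lt_def, Fin.val_castSucc, Fin.val_succ] at h₀ h₁ h₂
  omega

theorem removeEar (hE : IsPolygonTriangulation (n := m + 3) E)
    (h : E k.castSucc.castSucc k.succ.succ) :
    IsPolygonTriangulation (n := m + 2) fun i j =>
      E (k.succ.castSucc.succAbove i) (k.succ.castSucc.succAbove j) where
  lt i j hij := Fin.succAbove_lt_succAbove_iff.1 (hE.lt _ _ hij)
  noncrossing i j p q hij hpq := by
    simpa only [Fin.succAbove_lt_succAbove_iff] using hE.noncrossing _ _ _ _ hij hpq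
  maximal i j hij H := by
    refine hE.maximal _ _ (Fin.succAbove_lt_succAbove_iff.2 hij) fun p q hpq => ?_
    by_cases hc : p = k.succ.castSucc ∨ q = k.succ.castSucc
    · have hpq' := hE.lt _ _ hpq
      have hear := hE.val_eq_of_ear h hpq
      simp only [Fin.lt_def, Fin.ext_iff, Fin.val_castSucc, Fin.val_succ] at hc hpq' ⊢
      omega
    · push Not at hc
      obtain ⟨p, rfl⟩ := Fin.exists_succAbove_eq hc.1
      obtain ⟨q, rfl⟩ := Fin.exists_succAbove_eq hc.2
      simpa only [Fin.succAbove_lt_succAbove_iff] using H p q hpq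

end

end IsPolygonTriangulation

/-! ### Gluing triangles to polygons -/

theorem map_δ (X : SSet.{u}) {n : ℕ} (i : Fin (n + 2)) {c : SimplexCategory} (f : ⦋n + 1⦌ ⟶ c)
    (y : X.obj (op c)) : X.δ i (X.map f.op y) = X.map (SimplexCategory.δ i ≫ f).op y :=
  map_map_op X _ _ y

theorem map_δ' (X : SSet.{u}) {n : ℕ} (i : Fin (n + 2)) {c : SimplexCategory} (f : c ⟶ ⦋n⦌)
    (y : X _⦋n + 1⦌) : X.map f.op (X.δ i y) = X.map (f ≫ SimplexCategory.δ i).op y :=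
  map_map_op X _ _ y

/-- The Segal condition for gluing a triangle to a polygon along its side from `k` to `k + 1`:
the corner of the triangle becomes the vertex `k + 1` of the larger polygon. -/
def HasEarFillers (X : SSet.{u}) : Prop :=
  ∀ {m : ℕ} (k : Fin (m + 2)) (y : X _⦋m + 2⦌) (t : X _⦋2⦌),
    X.map (SimplexCategory.mkOfSucc k).op y = X.δ 1 t →
      ∃! w : X _⦋m + 3⦌, X.δ k.succ.castSucc w = y ∧ X.map (earTriangle k).op w = t

theorem earTriangle_zero {n : ℕ} (k : Fin (n + 1)) : earTriangle k 0 = k.castSucc.castSucc :=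
  Fin.ext (zero_add _)

theorem earTriangle_one {n : ℕ} (k : Fin (n + 1)) : earTriangle k 1 = k.succ.castSucc :=
  Fin.ext (add_comm _ _)

theorem earTriangle_two {n : ℕ} (k : Fin (n + 1)) : earTriangle k 2 = k.succ.succ :=
  Fin.ext (add_comm _ _)

theorem δ_one_earTriangle {m : ℕ} (k : Fin (m + 2)) :
    SimplexCategory.δ 1 ≫ earTriangle k =
      SimplexCategory.mkOfSucc k ≫ SimplexCategory.δ k.succ.castSucc := by
  refine simplexHom_ext _ _ fun i => ?_
  simp only [comp_val, δ_val, earTriangle_val, mkOfSucc_val, Fin.val_castSucc, Fin.val_succ]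
  fin_cases i <;> simp
  omega

/-- A triangle of the polygon without the vertex `k + 1`, as a triangle of the whole polygon. -/
def PolygonTriangle.face {m : ℕ} {E : Fin (m + 4) → Fin (m + 4) → Prop} {k : Fin (m + 2)}
    (t : PolygonTriangle (n := m + 2) fun i j =>
      E (k.succ.castSucc.succAbove i) (k.succ.castSucc.succAbove j)) :
    PolygonTriangle (n := m + 3) E :=
  ⟨t.1 ≫ SimplexCategory.δ k.succ.castSucc, t.2⟩

namespace IsPolygonTriangulation

theorem triangle_eq_id {E : Fin 3 → Fin 3 → Prop} (hE : IsPolygonTriangulation (n := 2) E)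
    (t : PolygonTriangle (n := 2) E) : t.1 = 𝟙 _ := by
  have h01 : (t.1 0).val < (t.1 1).val := hE.lt _ _ t.2.1
  have h12 : (t.1 1).val < (t.1 2).val := hE.lt _ _ t.2.2.1
  have h2 : (t.1 2).val < 3 := (t.1 2).isLt
  refine simplexHom_ext _ _ fun i => ?_
  fin_cases i
  · exact show (t.1 0).val = 0 by omega
  · exact show (t.1 1).val = 1 by omega
  · exact show (t.1 2).val = 2 by omega

theorem bijective_segalMap_two (X : SSet.{u}) {E : Fin 3 → Fin 3 → Prop}
    (hE : IsPolygonTriangulation (n := 2) E) : Function.Bijective (segalMap X (n := 2) E) := by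
  let t₀ : PolygonTriangle (n := 2) E := ⟨𝟙 _, hE.side 0, hE.side 1, hE.zero_last two_pos⟩
  have eq_t₀ (t) : t = t₀ := Subtype.ext (hE.triangle_eq_id t)
  refine ⟨fun y y' h => ?_, fun x => ⟨x.1 t₀, Subtype.ext (funext fun t => ?_)⟩⟩
  · simpa only [segalMap, t₀, map_id_op] using congrFun (congrArg Subtype.val h) t₀
  · rw [eq_t₀ t]
    exact map_id_op X _

section

variable {m : ℕ} {E : Fin (m + 4) → Fin (m + 4) → Prop} {k : Fin (m + 2)}

/-- The triangle cut off by the diagonal from `k` to `k + 2`. -/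
def ear (hE : IsPolygonTriangulation (n := m + 3) E) (h : E k.castSucc.castSucc k.succ.succ) :
    PolygonTriangle (n := m + 3) E :=
  ⟨earTriangle k, by
    rw [earTriangle_zero, earTriangle_one, earTriangle_two]
    exact ⟨hE.side k.castSucc, hE.side k.succ, h⟩⟩

theorem eq_ear_or_face (hE : IsPolygonTriangulation (n := m + 3) E)
    (h : E k.castSucc.castSucc k.succ.succ) (t : PolygonTriangle (n := m + 3) E) :
    t = hE.ear h ∨ ∃ t', t = PolygonTriangle.face (k := k) t' := by
  have h01 := hE.val_eq_of_ear h t.2.1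
  have h12 := hE.val_eq_of_ear h t.2.2.1
  have h02 := hE.val_eq_of_ear h t.2.2.2
  by_cases h1 : (t.1 1).val = k.val + 1
  · refine .inl (Subtype.ext (simplexHom_ext _ _ fun i => ?_))
    rw [ear, earTriangle_val]
    fin_cases i
    · exact show (t.1 0).val = 0 + k.val by omega
    · exact show (t.1 1).val = 1 + k.val by omega
    · exact show (t.1 2).val = 2 + k.val by omega
  · have hne (i : Fin 3) : (t.1 i).val ≠ k.val + 1 := by
      have l01 : (t.1 0).val < (t.1 1).val := hE.lt _ _ t.2.1
      have l12 : (t.1 1).val < (t.1 2).val := hE.lt _ _ t.2.2.1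
      fin_cases i
      · exact show (t.1 0).val ≠ k.val + 1 by omega
      · exact h1
      · exact show (t.1 2).val ≠ k.val + 1 by omega
    have e : t.1 = (t.1 ≫ SimplexCategory.σ k.castSucc) ≫ SimplexCategory.δ k.succ.castSucc := by
      refine simplexHom_ext _ _ fun i => ?_
      have := hne i
      simp only [comp_val, δ_val, σ_val, Fin.val_castSucc, Fin.val_succ]
      split_ifs <;> omega
    have ht := t.2
    rw [e] at ht
    exact .inr ⟨⟨_, ht⟩, Subtype.ext e⟩

end

end IsPolygonTriangulation

namespace HasEarFillers

variable {X : SSet.{u}} {m : ℕ} {E : Fin (m + 4) → Fin (m + 4) → Prop} {k : Fin (m + 2)}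

theorem injective_segalMap (hX : HasEarFillers X) (hE : IsPolygonTriangulation (n := m + 3) E)
    (h : E k.castSucc.castSucc k.succ.succ)
    (hinj : Function.Injective (segalMap X (n := m + 2) fun i j =>
      E (k.succ.castSucc.succAbove i) (k.succ.castSucc.succAbove j))) :
    Function.Injective (segalMap X (n := m + 3) E) := by
  intro y y' hyy'
  have htri (t : PolygonTriangle (n := m + 3) E) : X.map t.1.op y = X.map t.1.op y' :=
    congrFun (congrArg Subtype.val hyy') t
  have hface : X.δ k.succ.castSucc y = X.δ k.succ.castSucc y' := by
    refine hinj (Subtype.ext (funext fun t => ?_))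
    simp only [segalMap, map_δ']
    exact htri t.face
  refine (hX k (X.δ k.succ.castSucc y') (X.map (earTriangle k).op y') ?_).unique
    ⟨hface, htri (hE.ear h)⟩ ⟨rfl, rfl⟩
  rw [map_δ, map_δ', δ_one_earTriangle]

theorem surjective_segalMap (hX : HasEarFillers X) (hE : IsPolygonTriangulation (n := m + 3) E)
    (h : E k.castSucc.castSucc k.succ.succ)
    (hsurj : Function.Surjective (segalMap X (n := m + 2) fun i j =>
      E (k.succ.castSucc.succAbove i) (k.succ.castSucc.succAbove j))) :
    Function.Surjective (segalMap X (n := m + 3) E) := by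
  intro x
  obtain ⟨y, hy⟩ := hsurj ⟨fun t => x.1 t.face, fun t t' i j htt' => x.2 _ _ _ _ <| by
    simp only [PolygonTriangle.face, ← Category.assoc, htt']⟩
  have hface (t : PolygonTriangle (n := m + 2) fun i j =>
      E (k.succ.castSucc.succAbove i) (k.succ.castSucc.succAbove j)) :
      X.map t.1.op y = x.1 t.face := congrFun (congrArg Subtype.val hy) t
  have hglue : X.map (SimplexCategory.mkOfSucc k).op y = X.δ 1 (x.1 (hE.ear h)) := by
    obtain ⟨t, s, hts⟩ := (hE.removeEar h).exists_triangle_of_side (by omega) k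
    rw [← hts, ← map_δ, hface]
    refine x.2 _ _ _ _ ?_
    rw [PolygonTriangle.face, ← Category.assoc, hts]
    exact (δ_one_earTriangle k).symm
  obtain ⟨w, ⟨rfl, hw⟩, -⟩ := hX k y (x.1 (hE.ear h)) hglue
  refine ⟨w, Subtype.ext (funext fun t => ?_)⟩
  rcases hE.eq_ear_or_face h t with rfl | ⟨t, rfl⟩
  · exact hw
  · rw [← hface, map_δ']
    rfl

theorem bijective_segalMap (hX : HasEarFillers X) (n : ℕ) {E : Fin (n + 3) → Fin (n + 3) → Prop}
    (hE : IsPolygonTriangulation (n := n + 2) E) :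
    Function.Bijective (segalMap X (n := n + 2) E) := by
  induction n with
  | zero => exact hE.bijective_segalMap_two X
  | succ m ih =>
    obtain ⟨k, hk⟩ := hE.exists_ear
    have hface := ih (hE.removeEar hk)
    exact ⟨hX.injective_segalMap hE hk hface.1, hX.surjective_segalMap hE hk hface.2⟩

theorem isTwoSegal (hX : HasEarFillers X) : IsTwoSegal X := by
  intro n hn E hE
  obtain ⟨n, rfl⟩ := Nat.exists_eq_add_of_le' (Nat.le_of_succ_le hn)
  exact hX.bijective_segalMap n hE

end HasEarFillers

/-! ### The Waldhausen construction is unital 2-Segal -/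

namespace AugDoubleFunctor

variable {D : AugStDoubleCat.{u}}

/-- The restriction of a double functor on `W n` along a map of the simplex category; these are the
structure maps of the Waldhausen construction. -/
def restrict {m n : ℕ} (F : AugDoubleFunctor (W n) D) (f : ⦋m⦌ ⟶ ⦋n⦌) : AugDoubleFunctor (W m) D :=
  (W.map f.toOrderHom).comp F

section Restrict

variable {m n : ℕ} (F : AugDoubleFunctor (W n) D) (f : ⦋m⦌ ⟶ ⦋n⦌) {i j l : Fin (m + 1)}
  {i' j' l' : Fin (n + 1)} (hij : i ≤ j) (hjl : j ≤ l) (hi : f i = i') (hj : f j = j')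
  (hl : f l = l')

theorem wOb_restrict : (F.restrict f).wOb i j hij =
    F.wOb i' j' (hi ▸ hj ▸ f.toOrderHom.monotone hij) := by
  subst hi hj
  rfl

theorem wHor_restrict : (F.restrict f).wHor i j l hij hjl =
    F.wHor i' j' l' (hi ▸ hj ▸ f.toOrderHom.monotone hij)
      (hj ▸ hl ▸ f.toOrderHom.monotone hjl) := by
  subst hi hj hl
  rfl

end Restrict

section Insert

variable {n : ℕ}

theorem exists_firstRow (F : AugDoubleFunctor (W n) D) : ∃ f : ℕ → D.Hor,
    (∀ j, D.hor.tgt (f j) = D.hor.src (f (j + 1))) ∧ (∀ j h, F.wOb 0 j h = D.hor.src (f j)) ∧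
      ∀ j l hj hl, l.val = j.val + 1 → F.wHor 0 j l hj hl = f j := by
  let clamp (j : ℕ) : Fin (n + 1) := ⟨min j n, by omega⟩
  have clamp_val (j : Fin (n + 1)) : clamp j = j := Fin.ext (min_eq_left (Nat.le_of_lt_succ j.isLt))
  have clamp_le (j : ℕ) : clamp j ≤ clamp (j + 1) := min_le_min_right n (Nat.le_succ j)
  refine ⟨fun j => F.wHor 0 (clamp j) (clamp (j + 1)) (Fin.zero_le _) (clamp_le j),
    fun j => ?_, fun j h => ?_, fun j l hj hl hjl => F.wHor_congr _ _ rfl (clamp_val j).symm ?_⟩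
  · rw [tgt_wHor, src_wHor]
  · rw [src_wHor]
    exact F.wOb_congr _ rfl (clamp_val j).symm
  · rw [← hjl, clamp_val]

/-- The sequence obtained from `Y` by replacing the term `Y k` with the two terms `f, g`. -/
def insertTerm {M : Type u} (Y : ℕ → M) (k : ℕ) (f g : M) (j : ℕ) : M :=
  if j < k then Y j else if j = k then f else if j = k + 1 then g else Y (j - 1)

section InsertTerm

variable {O M : Type u} (Y : ℕ → M) {j k : ℕ} (f g : M)

theorem insertTerm_of_lt (h : j < k) : insertTerm Y k f g j = Y j := if_pos h

theorem insertTerm_self : insertTerm Y k f g k = f := by simp [insertTerm]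

theorem insertTerm_succ_self : insertTerm Y k f g (k + 1) = g := by simp [insertTerm]

theorem insertTerm_succ_of_lt (h : k < j) : insertTerm Y k f g (j + 1) = Y j := by
  simp [insertTerm, show ¬ j + 1 < k by omega, show j + 1 ≠ k by omega, h.ne']

variable {Y f g} {C : CatStr O M}

theorem src_insertTerm_of_le (hsrc : C.src f = C.src (Y k)) (h : j ≤ k) :
    C.src (insertTerm Y k f g j) = C.src (Y j) := by
  rcases h.lt_or_eq with h | rfl
  · rw [insertTerm_of_lt Y f g h]
  · rw [insertTerm_self, hsrc]

theorem tgt_insertTerm (hY : ∀ j, C.tgt (Y j) = C.src (Y (j + 1))) (h : C.tgt f = C.src g)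
    (hsrc : C.src f = C.src (Y k)) (htgt : C.tgt g = C.tgt (Y k)) (j : ℕ) :
    C.tgt (insertTerm Y k f g j) = C.src (insertTerm Y k f g (j + 1)) := by
  rcases lt_trichotomy j k with hj | rfl | hj
  · rw [insertTerm_of_lt Y f g hj, src_insertTerm_of_le hsrc hj, hY]
  · rw [insertTerm_self, insertTerm_succ_self, h]
  · obtain ⟨j, rfl⟩ := Nat.exists_eq_add_one_of_ne_zero (Nat.ne_zero_of_lt hj)
    rw [insertTerm_succ_of_lt Y f g hj, ← hY]
    rcases (Nat.le_of_lt_succ hj).lt_or_eq with hj | rfl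
    · rw [insertTerm_succ_of_lt Y f g hj]
    · rw [insertTerm_succ_self, htgt]

end InsertTerm

theorem restrict_δ_eq {w : AugDoubleFunctor (W (n + 1)) D} {y : AugDoubleFunctor (W n) D}
    {k : Fin n} (h₀ : w.wOb 0 0 le_rfl = y.wOb 0 0 le_rfl)
    (hlt : ∀ j l (hjl : j ≤ l), j < k.castSucc → l.val = j.val + 1 →
      w.wHor 0 j.castSucc l.castSucc (Fin.zero_le _) hjl = y.wHor 0 j l (Fin.zero_le _) hjl)
    (heq : w.wHor 0 k.castSucc.castSucc k.succ.succ (Fin.zero_le _)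
        (Nat.le_add_right k.val 2) =
      y.wHor 0 k.castSucc k.succ (Fin.zero_le _) Fin.castSucc_lt_succ.le)
    (hgt : ∀ j l (hjl : j ≤ l), k.castSucc < j → l.val = j.val + 1 →
      w.wHor 0 j.succ l.succ (Fin.zero_le _) (Fin.succ_le_succ_iff.2 hjl) =
        y.wHor 0 j l (Fin.zero_le _) hjl) :
    w.restrict (SimplexCategory.δ k.succ.castSucc) = y := by
  have hδ0 : SimplexCategory.δ k.succ.castSucc 0 = 0 :=
    Fin.succAbove_ne_zero_zero (Fin.castSucc_ne_zero_iff.2 (Fin.succ_ne_zero k))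
  refine ext_wHor_succ ((w.wOb_restrict _ _ hδ0 hδ0).trans h₀) fun j l hj hl hjl => ?_
  rcases lt_trichotomy j k.castSucc with hjk | rfl | hjk
  · exact (w.wHor_restrict _ hj hl hδ0 (Fin.succAbove_of_castSucc_lt _ _ (by simp; omega))
      (Fin.succAbove_of_castSucc_lt _ _ (by simp; omega))).trans (hlt j l hl hjk hjl)
  · obtain rfl : l = k.succ := Fin.ext hjl
    exact (w.wHor_restrict _ hj hl hδ0 (Fin.succAbove_of_castSucc_lt _ _ (by simp))
      (Fin.succAbove_of_le_castSucc _ _ (by simp))).trans heq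
  · exact (w.wHor_restrict _ hj hl hδ0 (Fin.succAbove_of_le_castSucc _ _ (by simp; omega))
      (Fin.succAbove_of_le_castSucc _ _ (by simp; omega))).trans (hgt j l hl hjk hjl)

theorem exists_insert (y : AugDoubleFunctor (W n) D) (k : Fin n) {f g : D.Hor}
    (h : D.hor.tgt f = D.hor.src g)
    (hy : y.wHor 0 k.castSucc k.succ (Fin.zero_le _) Fin.castSucc_lt_succ.le = D.hor.comp f g h) :
    ∃ w : AugDoubleFunctor (W (n + 1)) D, w.restrict (SimplexCategory.δ k.succ.castSucc) = y ∧
      w.wHor 0 k.castSucc.castSucc k.succ.castSucc (Fin.zero_le _)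
        (Fin.castSucc_le_castSucc_iff.2 Fin.castSucc_lt_succ.le) = f ∧
      w.wHor 0 k.succ.castSucc k.succ.succ (Fin.zero_le _) Fin.castSucc_lt_succ.le = g := by
  obtain ⟨Y, hY, hYob, hYhor⟩ := y.exists_firstRow
  have hYk : Y k = D.hor.comp f g h := (hYhor _ _ _ _ (by simp)).symm.trans hy
  have hsrc : D.hor.src f = D.hor.src (Y k) := by rw [hYk, D.hor.src_comp]
  have hZ := tgt_insertTerm hY h hsrc (by rw [hYk, D.hor.tgt_comp])
  have hZ0 := src_insertTerm_of_le (g := g) hsrc (Nat.zero_le k.val)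
  obtain ⟨w, hwob, hw⟩ := exists_wHor_eq (n + 1) (insertTerm Y k f g) hZ
    (by rw [hZ0]; exact hYob 0 le_rfl ▸ y.wOb_self_mem 0)
  have hwf := (hw k.castSucc.castSucc k.succ.castSucc (Fin.zero_le _)
    (Fin.castSucc_le_castSucc_iff.2 Fin.castSucc_lt_succ.le) (by simp)).trans
      (insertTerm_self Y f g)
  have hwg := (hw k.succ.castSucc k.succ.succ (Fin.zero_le _) Fin.castSucc_lt_succ.le
    (by simp)).trans (insertTerm_succ_self Y f g)
  refine ⟨w, restrict_δ_eq ?_ (fun j l hjl hj hl => ?_) ?_ fun j l hjl hj hl => ?_, hwf, hwg⟩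
  · exact (hwob _ _).trans (hZ0.trans (hYob 0 _).symm)
  · rw [hYhor j l _ hjl hl, hw _ _ _ _ (by simp [hl])]
    exact insertTerm_of_lt Y f g hj
  · rw [hy, ← D.hor.comp_congr hwf hwg (by rw [tgt_wHor, src_wHor]) h, wHor_comp]
  · rw [hYhor j l _ hjl hl, hw _ _ _ _ (by simp [hl])]
    exact insertTerm_succ_of_lt Y f g hj

end Insert

section Ear

variable {n : ℕ}

theorem wHor_eq_bottom {F : AugDoubleFunctor (W n) D} {i j l : Fin (n + 1)} (hij : i ≤ j)
    (hjl : j ≤ l) {b a : D.Sq} (hba : D.hsq.tgt b = D.hsq.src a)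
    (hb : D.vsq.src b = F.wHor 0 i j (Fin.zero_le i) hij)
    (hb' : D.ver.tgt (D.hsq.src b) ∈ D.A)
    (ha : D.vsq.src a = F.wHor 0 j l (Fin.zero_le j) hjl) : F.wHor i j l hij hjl = D.vsq.tgt a := by
  have hsq : F.wSq 0 i i j (Fin.zero_le i) le_rfl hij = b := by
    refine D.stable.ext_span ?_ ?_
    · rw [wSq_top, hb]
    · rw [wSq_left, wVer_aug]
      refine (eq_augVer ?_ hb').symm
      rw [← hor_src_top, hb, src_wHor]
  have hsq' : F.wSq 0 i j l (Fin.zero_le i) hij hjl = a := by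
    refine D.stable.ext_span ?_ ?_
    · rw [wSq_top, ha]
    · rw [wSq_left, ← hba, ← hsq, wSq_right]
  rw [← hsq', wSq_bottom]

theorem exists_ear {m : ℕ} (k : Fin (m + 1)) (y : AugDoubleFunctor (W (m + 1)) D)
    (t : AugDoubleFunctor (W 2) D)
    (h : y.restrict (SimplexCategory.mkOfSucc k) = t.restrict (SimplexCategory.δ 1)) :
    ∃ w : AugDoubleFunctor (W (m + 2)) D,
      w.restrict (SimplexCategory.δ k.succ.castSucc) = y ∧ w.restrict (earTriangle k) = t := by
  have hob : y.wOb k.castSucc k.succ Fin.castSucc_lt_succ.le = t.wOb 0 2 (Fin.zero_le _) :=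
    congrArg (fun F => F.wOb 0 1 (Fin.zero_le _)) h
  let q := y.wSq 0 k.castSucc k.castSucc k.succ (Fin.zero_le _) le_rfl Fin.castSucc_lt_succ.le
  have hq : D.vsq.tgt q = D.hor.comp (t.wHor 0 0 1 le_rfl (Fin.zero_le _))
      (t.wHor 0 1 2 (Fin.zero_le _) (by decide)) (by rw [tgt_wHor, src_wHor]) := by
    rw [wSq_bottom, wHor_aug, hob, ← wHor_aug, wHor_comp]
  obtain ⟨b, a, hba, -, ha, hqba⟩ := D.stable.eq_comp_of_bottom_eq_comp q _ hq
  obtain ⟨w, hwy, hwb, hwa⟩ := y.exists_insert k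
    (f := D.vsq.src b) (g := D.vsq.src a) (by rw [hor_tgt_top, hba, hor_src_top])
    (by rw [← top_comp b a hba, ← hqba, wSq_top])
  refine ⟨w, hwy, ext_two ?_⟩
  have hbA : D.ver.tgt (D.hsq.src b) ∈ D.A := by
    rw [← D.hsq.src_comp b a hba, ← hqba, wSq_left, tgt_wVer]
    exact y.wOb_self_mem _
  rw [← ha, ← w.wHor_eq_bottom _ _ hba hwb.symm hbA hwa.symm]
  exact w.wHor_restrict _ _ _ (earTriangle_zero k) (earTriangle_one k) (earTriangle_two k)

theorem wHor_eq_of_restrict_δ_eq {w w' : AugDoubleFunctor (W (n + 1)) D} {p : Fin (n + 2)}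
    (h : w.restrict (SimplexCategory.δ p) = w'.restrict (SimplexCategory.δ p)) {i j l : Fin (n + 2)}
    (hij : i ≤ j) (hjl : j ≤ l) (hi : i ≠ p) (hj : j ≠ p) (hl : l ≠ p) :
    w.wHor i j l hij hjl = w'.wHor i j l hij hjl := by
  obtain ⟨i, rfl⟩ := Fin.exists_succAbove_eq hi
  obtain ⟨j, rfl⟩ := Fin.exists_succAbove_eq hj
  obtain ⟨l, rfl⟩ := Fin.exists_succAbove_eq hl
  exact congrArg (fun F => F.wHor i j l (Fin.succAbove_le_succAbove_iff.1 hij)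
    (Fin.succAbove_le_succAbove_iff.1 hjl)) h

theorem wVer_eq_of_restrict_δ_eq {w w' : AugDoubleFunctor (W (n + 1)) D} {p : Fin (n + 2)}
    (h : w.restrict (SimplexCategory.δ p) = w'.restrict (SimplexCategory.δ p)) {i j l : Fin (n + 2)}
    (hij : i ≤ j) (hjl : j ≤ l) (hi : i ≠ p) (hj : j ≠ p) (hl : l ≠ p) :
    w.wVer i j l hij hjl = w'.wVer i j l hij hjl := by
  obtain ⟨i, rfl⟩ := Fin.exists_succAbove_eq hi
  obtain ⟨j, rfl⟩ := Fin.exists_succAbove_eq hj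
  obtain ⟨l, rfl⟩ := Fin.exists_succAbove_eq hl
  exact congrArg (fun F => F.wVer i j l (Fin.succAbove_le_succAbove_iff.1 hij)
    (Fin.succAbove_le_succAbove_iff.1 hjl)) h

theorem eq_of_restrict_δ_eq {w w' : AugDoubleFunctor (W (n + 1)) D} {a p b : Fin (n + 2)}
    (hap : p.val = a.val + 1) (hpb : b.val = p.val + 1) (hap' : a ≤ p) (hpb' : p ≤ b)
    (h : w.restrict (SimplexCategory.δ p) = w'.restrict (SimplexCategory.δ p))
    (hear : w.wHor a p b hap' hpb' = w'.wHor a p b hap' hpb') : w = w' := by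
  have hp0 : 0 ≠ p := fun hc => by simp [← hc] at hap
  have ha : a ≠ p := fun hc => by simp [hc] at hap
  have hb : b ≠ p := fun hc => by simp [hc] at hpb
  -- In the square `(0, a, p, b)` the right side does not involve `p` and the bottom side is the
  -- given one, so the square, and with it the top side `(0, p, b)`, is determined.
  have hapb : w.wSq 0 a p b (Fin.zero_le a) hap' hpb' = w'.wSq 0 a p b (Fin.zero_le a) hap' hpb' :=
    D.stable.ext_cospan
      (by simpa only [wSq_right] using wVer_eq_of_restrict_δ_eq h _ _ hp0 ha hb)
      (by simpa only [wSq_bottom])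
  have haap : w.wSq 0 a a p (Fin.zero_le a) le_rfl hap' =
      w'.wSq 0 a a p (Fin.zero_le a) le_rfl hap' := by
    refine D.stable.ext_cospan ?_ ?_
    · simpa only [wSq_left, wSq_right] using congrArg D.hsq.src hapb
    · simp only [wSq_bottom, wHor_aug, ← w.src_wHor a p b hap' hpb', hear, src_wHor]
  refine ext_wHor_succ ?_ fun j l hj hl hjl => ?_
  · rw [← w.src_wHor 0 0 a le_rfl (Fin.zero_le a),
      wHor_eq_of_restrict_δ_eq h _ _ hp0 hp0 ha, src_wHor]
  · by_cases hjp : j = p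
    · obtain rfl := hjp
      obtain rfl : l = b := Fin.ext (hjl.trans hpb.symm)
      simpa only [wSq_top] using congrArg D.vsq.src hapb
    by_cases hlp : l = p
    · obtain rfl := hlp
      obtain rfl : j = a := Fin.ext (by omega)
      simpa only [wSq_top] using congrArg D.vsq.src haap
    · exact wHor_eq_of_restrict_δ_eq h _ _ hp0 hjp hlp

end Ear

end AugDoubleFunctor

theorem hasEarFillers_waldhausen (D : AugStDoubleCat.{u}) :
    HasEarFillers (waldhausenConstruction.obj D) := by
  intro m k y t hyt
  obtain ⟨w, hwy, hwt⟩ := exists_ear (D := D) k y t hyt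
  refine ⟨w, ⟨hwy, hwt⟩, fun w' ⟨hwy', hwt'⟩ => ?_⟩
  refine eq_of_restrict_δ_eq (D := D) (a := k.castSucc.castSucc) (b := k.succ.succ) rfl rfl
    (Nat.le_succ k.val) (Nat.le_succ _) (hwy'.trans hwy.symm) ?_
  have hear (F : AugDoubleFunctor (W (m + 3)) D) :=
    F.wHor_restrict (earTriangle k) (Fin.zero_le 1) (show (1 : Fin 3) ≤ 2 by decide)
      (earTriangle_zero k) (earTriangle_one k) (earTriangle_two k)
  exact (hear w').symm.trans ((congrArg (fun F : AugDoubleFunctor (W 2) D =>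
    F.wHor 0 1 2 (Fin.zero_le _) (by decide)) (hwt'.trans hwt.symm)).trans (hear w))

namespace AugDoubleFunctor

variable {D : AugStDoubleCat.{u}} {n : ℕ}

theorem wHor_eq_one_of_mem (F : AugDoubleFunctor (W n) D) {i j : Fin (n + 1)} (hij : i ≤ j)
    (h : F.wOb i j hij ∈ D.A) :
    F.wHor 0 i j (Fin.zero_le i) hij = D.hor.one (F.wOb 0 j (Fin.zero_le j)) := by
  have hsq : F.wSq 0 i i j (Fin.zero_le i) le_rfl hij =
      D.hsq.one (F.wVer 0 i j (Fin.zero_le i) hij) := by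
    refine D.stable.ext_cospan ?_ ?_
    · rw [wSq_right, D.hsq.tgt_one]
    · rw [wSq_bottom, D.one_functor.tgt, tgt_wVer, wHor_aug, augHor_of_mem h]
  rw [← F.wSq_top 0 i i j (Fin.zero_le i) le_rfl hij, hsq, D.one_functor.src, src_wVer]

theorem wOb_zero_eq_of_mem (F : AugDoubleFunctor (W n) D) {i j : Fin (n + 1)} (hij : i ≤ j)
    (h : F.wOb i j hij ∈ D.A) : F.wOb 0 i (Fin.zero_le i) = F.wOb 0 j (Fin.zero_le j) := by
  rw [← F.src_wHor 0 i j (Fin.zero_le i) hij, F.wHor_eq_one_of_mem hij h, D.hor.src_one]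

theorem wHor_zero_eq_of_mem (F : AugDoubleFunctor (W n) D) {i j l : Fin (n + 1)} (hij : i ≤ j)
    (hjl : j ≤ l) (h : F.wOb i j hij ∈ D.A) :
    F.wHor 0 i l (Fin.zero_le i) (hij.trans hjl) = F.wHor 0 j l (Fin.zero_le j) hjl := by
  have hone : F.wHor 0 i j (Fin.zero_le i) hij =
      D.hor.one (D.hor.src (F.wHor 0 j l (Fin.zero_le j) hjl)) := by
    rw [F.wHor_eq_one_of_mem hij h, src_wHor]
  rw [← F.wHor_comp 0 i j l (Fin.zero_le i) hij hjl (by rw [tgt_wHor, src_wHor]),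
    D.hor.comp_congr hone rfl _ (D.hor.tgt_one _), D.hor.one_comp]

theorem restrict_σ_δ_eq_self (F : AugDoubleFunctor (W (n + 1)) D) (i : Fin (n + 1))
    (h : F.wOb i.castSucc i.succ Fin.castSucc_lt_succ.le ∈ D.A) :
    F.restrict ((SimplexCategory.σ i : ⦋n + 1⦌ ⟶ ⦋n⦌) ≫ SimplexCategory.δ i.succ) = F := by
  set θ : ⦋n + 1⦌ ⟶ ⦋n + 1⦌ := SimplexCategory.σ i ≫ SimplexCategory.δ i.succ with hθ
  have hθval (j : Fin (n + 2)) : (θ j).val = if j.val = i.val + 1 then i.val else j.val := by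
    simp only [hθ, comp_val, σ_val, δ_val, Fin.val_succ]
    split_ifs <;> omega
  have hθ_succ : θ i.succ = i.castSucc := Fin.ext ((hθval _).trans (if_pos rfl))
  have hθ_ne (j : Fin (n + 2)) (hj : j ≠ i.succ) : θ j = j :=
    Fin.ext ((hθval j).trans (if_neg fun h => hj (Fin.ext h)))
  have hθ_zero : θ 0 = 0 := hθ_ne 0 (Fin.succ_ne_zero i).symm
  refine ext_wHor_succ (F.wOb_restrict θ le_rfl hθ_zero hθ_zero) fun j l hj hl hjl => ?_
  by_cases hji : j = i.succ
  · subst hji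
    rw [F.wHor_restrict θ hj hl hθ_zero hθ_succ (hθ_ne l fun h => by simp [h] at hjl)]
    exact F.wHor_zero_eq_of_mem Fin.castSucc_lt_succ.le hl h
  by_cases hli : l = i.succ
  · subst hli
    obtain rfl : j = i.castSucc := Fin.ext (Nat.succ.inj hjl).symm
    rw [F.wHor_restrict θ hj hl hθ_zero (hθ_ne _ hji) hθ_succ, wHor_one,
      F.wHor_eq_one_of_mem hl h, F.wOb_zero_eq_of_mem hl h]
  · exact F.wHor_restrict θ hj hl hθ_zero (hθ_ne j hji) (hθ_ne l hli)

theorem wOb_eq_wOb_self_of_mem (F : AugDoubleFunctor (W n) D) {i j : Fin (n + 1)} (hij : i ≤ j)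
    (h : F.wOb i j hij ∈ D.A) : F.wOb i j hij = F.wOb i i le_rfl := by
  rw [← F.src_wHor i i j le_rfl hij, wHor_aug, augHor_of_mem h, D.hor.src_one]

end AugDoubleFunctor

theorem mkOfSucc_comp_σ {n : ℕ} (i : Fin (n + 2)) :
    SimplexCategory.mkOfSucc i ≫ SimplexCategory.σ i =
      SimplexCategory.σ (0 : Fin 1) ≫ SimplexCategory.const ⦋0⦌ ⦋n + 1⦌ i := by
  refine simplexHom_ext _ _ fun j => ?_
  have hj : j.val < 2 := j.isLt
  change (SimplexCategory.σ i (SimplexCategory.mkOfSucc i j)).val = i.val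
  rw [σ_val, mkOfSucc_val]
  split_ifs <;> omega

theorem isUnitalTwoSegal_waldhausen (D : AugStDoubleCat.{u}) :
    IsUnitalTwoSegal (waldhausenConstruction.obj D) where
  twoSegal := HasEarFillers.isTwoSegal (hasEarFillers_waldhausen D)
  unital n i := by
    set X := waldhausenConstruction.obj D
    refine (Limits.Types.isPullback_iff _ _ _ _).2 ⟨?_, fun y y' h => ?_, fun z F h => ?_⟩
    · exact ConcreteCategory.hom_ext _ _ fun y => map_map_eq X (mkOfSucc_comp_σ i).symm y
    · rw [← deg_face X SimplexCategory.δ_comp_σ_succ y, h.2,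
        deg_face X SimplexCategory.δ_comp_σ_succ y']
    · let F' : AugDoubleFunctor (W (n + 2)) D := F
      have hob : AugDoubleFunctor.wOb (D := D) z 0 0 le_rfl =
          F'.wOb i.castSucc i.succ Fin.castSucc_lt_succ.le :=
        congrArg (fun G : AugDoubleFunctor (W 1) D => G.wOb 0 1 (Fin.zero_le _)) h
      have hF : F'.wOb i.castSucc i.succ Fin.castSucc_lt_succ.le ∈ D.A :=
        hob ▸ AugDoubleFunctor.wOb_self_mem (D := D) z 0
      refine ⟨X.δ i.succ F, ext_zero (D := D) ?_,
        (map_map_op X _ _ F).trans (F'.restrict_σ_δ_eq_self i hF)⟩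
      have hδ : (SimplexCategory.δ i.succ : ⦋n + 1⦌ ⟶ ⦋n + 2⦌) i = i.castSucc :=
        Fin.succAbove_succ_self i
      exact (F'.wOb_restrict _ le_rfl hδ hδ).trans
        ((F'.wOb_eq_wOb_self_of_mem Fin.castSucc_lt_succ.le hF).symm.trans hob.symm)

/-! ### The path construction -/

theorem IsTwoSegal.bijective_app {X Y : SSet.{u}} (hX : IsTwoSegal X) (hY : IsTwoSegal Y)
    (φ : X ⟶ Y) (h₁ : Function.Injective (φ.app (op ⦋1⦌)))
    (h₂ : Function.Bijective (φ.app (op ⦋2⦌))) {n : ℕ} (hn : 3 ≤ n) :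
    Function.Bijective (φ.app (op ⦋n⦌)) := by
  have hE := earChords_isTriangulation n 0 (by omega)
  have hφ (t : ⦋2⦌ ⟶ ⦋n⦌) (y : X _⦋n⦌) :
      φ.app (op ⦋2⦌) (X.map t.op y) = Y.map t.op (φ.app (op ⦋n⦌) y) :=
    NatTrans.naturality_apply φ t.op y
  obtain ⟨hXinj, hXsurj⟩ := hX n hn _ hE
  refine ⟨fun y y' h => hXinj (Subtype.ext (funext fun t => h₂.1 ?_)), fun z => ?_⟩
  · exact (hφ t.1 y).trans ((congrArg (Y.map t.1.op) h).trans (hφ t.1 y').symm)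
  · choose g hg using h₂.2
    obtain ⟨y, hy⟩ := hXsurj ⟨fun t => g (Y.map t.1.op z), fun t t' i j h => h₁ <| by
      rw [← nat_face, ← nat_face, hg, hg, map_δ, map_δ, h]⟩
    refine ⟨y, (hY n hn _ hE).1 (Subtype.ext (funext fun t => ?_))⟩
    exact (hφ t.1 y).symm.trans ((congrArg _ (congrFun (congrArg Subtype.val hy) t)).trans (hg _))

section PathFunctor

variable {X : SSet.{u}} {m n : ℕ}

/-- The simplex of `Δ[n]` with a given increasing sequence of vertices. -/
def simplex (v : Fin (m + 1) → Fin (n + 1))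
    (hv : ∀ i : Fin m, v i.castSucc ≤ v i.succ := by simp [Fin.forall_fin_succ, *]) : ⦋m⦌ ⟶ ⦋n⦌ :=
  SimplexCategory.mkHom ⟨v, Fin.monotone_iff_le_succ.2 hv⟩

theorem δ_map_simplex {v : Fin (m + 2) → Fin (n + 1)} {w : Fin (m + 1) → Fin (n + 1)} {i hv hw}
    (y : X _⦋n⦌) (h : ∀ j, v (i.succAbove j) = w j := by intro j; fin_cases j <;> rfl) :
    X.δ i (X.map (simplex v hv).op y) = X.map (simplex w hw).op y := by
  rw [map_δ]
  exact congrArg (fun f => X.map (Quiver.Hom.op f) y)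
    (simplexHom_ext _ _ fun j => congrArg Fin.val (h j))

theorem map_simplex_eq_σ {v : Fin (m + 2) → Fin (n + 1)} {w : Fin (m + 1) → Fin (n + 1)} {i hv hw}
    (y : X _⦋n⦌) (h : ∀ j, v j = w (i.predAbove j) := by intro j; fin_cases j <;> rfl) :
    X.map (simplex v hv).op y = X.σ i (X.map (simplex w hw).op y) := by
  refine Eq.trans ?_ (map_map_op X (SimplexCategory.σ i) (simplex w hw) y).symm
  exact congrArg (fun f => X.map (Quiver.Hom.op f) y)
    (simplexHom_ext _ _ fun j => congrArg Fin.val (h j))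

/-- The double functor classified by a simplex `y` of a unital 2-Segal set: an object, a morphism or
a square of `W n` is sent to the face of `y` spanned by its indices. -/
noncomputable def pathFunctor (hX : IsUnitalTwoSegal X) (y : X _⦋n⦌) :
    AugDoubleFunctor (W n) (pathObj X hX) where
  ob | ⟨i, j, _⟩ => X.map (simplex ![i, j]).op y
  onHor | ⟨i, j, l, _, _⟩ => X.map (simplex ![i, j, l]).op y
  onVer | ⟨i, k, j, _, _⟩ => X.map (simplex ![i, k, j]).op y
  onSq | ⟨i, k, j, l, _, _, _⟩ => X.map (simplex ![i, k, j, l]).op y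
  hor := isFunctor_wHor (fun _ => δ_map_simplex y) (fun _ => δ_map_simplex y)
    (fun _ => map_simplex_eq_σ y) fun i j l m _ _ _ h =>
      (pathHor_comp hX.twoSegal (X.map (simplex ![i, j, l, m]).op y)
        (δ_map_simplex y) (δ_map_simplex y) h).trans (δ_map_simplex y)
  ver := isFunctor_wVer (fun _ => δ_map_simplex y) (fun _ => δ_map_simplex y)
    (fun _ => map_simplex_eq_σ y) fun i k m j _ _ _ h =>
      (pathVer_comp hX.twoSegal (X.map (simplex ![i, k, m, j]).op y)
        (δ_map_simplex y) (δ_map_simplex y) h).trans (δ_map_simplex y)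
  hsq := isFunctor_wHsq (fun _ => δ_map_simplex y) (fun _ => δ_map_simplex y)
    (fun _ => map_simplex_eq_σ y) fun i k j l m _ _ _ _ h =>
      (pathHsq_comp hX.twoSegal (X.map (simplex ![i, k, j, l, m]).op y)
        (δ_map_simplex y) (δ_map_simplex y) h).trans (δ_map_simplex y)
  vsq := isFunctor_wVsq (fun _ => δ_map_simplex y) (fun _ => δ_map_simplex y)
    (fun _ => map_simplex_eq_σ y) fun i k m j l _ _ _ _ h =>
      (pathVsq_comp hX.twoSegal (X.map (simplex ![i, k, m, j, l]).op y)
        (δ_map_simplex y) (δ_map_simplex y) h).trans (δ_map_simplex y)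
  aug := by
    rintro ⟨i, j, hij⟩ (rfl : i = j)
    exact ⟨X.map (simplex ![i]).op y, (map_simplex_eq_σ y).symm⟩

section Values

variable (hX : IsUnitalTwoSegal X) (y : X _⦋n⦌) {i j l : Fin (n + 1)} (hij : i ≤ j) (hjl : j ≤ l)

theorem wOb_pathFunctor : (pathFunctor hX y).wOb i j hij = X.map (simplex ![i, j]).op y := rfl

theorem wHor_pathFunctor :
    (pathFunctor hX y).wHor i j l hij hjl = X.map (simplex ![i, j, l]).op y := rfl

end Values

end PathFunctor

section PathUnit

variable {X : SSet.{u}} (hX : IsUnitalTwoSegal X)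

/-- The comparison map from a unital 2-Segal set to the Waldhausen construction of its path
construction, sending a simplex to the double functor it classifies. -/
noncomputable def toWaldhausen : X ⟶ waldhausenConstruction.obj (pathObj X hX) where
  app a := ↾(fun y => pathFunctor (n := a.unop.len) hX y)
  naturality a b f := by
    ext y
    refine ext_wHor_zero (F := pathFunctor hX (X.map f y)) fun j l _ _ => ?_
    refine (map_map_op X _ f.unop y).trans (congrArg (fun g => X.map (Quiver.Hom.op g) y) ?_)
    exact simplexHom_ext _ _ fun k => by fin_cases k <;> rfl

theorem bijective_toWaldhausen_zero : Function.Bijective ((toWaldhausen hX).app (op ⦋0⦌)) := by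
  have hob (y : X _⦋0⦌) : (pathFunctor hX y).wOb 0 0 le_rfl = X.σ 0 y :=
    congrArg (fun f => X.map (Quiver.Hom.op f) y)
      (simplexHom_ext _ _ fun k => by fin_cases k <;> rfl)
  refine ⟨fun y y' h => ?_, fun F => ?_⟩
  · have hσ : X.σ 0 y = X.σ 0 y' := by
      rw [← hob, ← hob]
      exact congrArg (fun F : AugDoubleFunctor (W 0) (pathObj X hX) => F.wOb 0 0 le_rfl) h
    rw [← deg_face X SimplexCategory.δ_comp_σ_self y, hσ, deg_face X SimplexCategory.δ_comp_σ_self]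
  · obtain ⟨z, hz⟩ := AugDoubleFunctor.wOb_self_mem (D := pathObj X hX) F 0
    exact ⟨z, ext_zero (D := pathObj X hX) ((hob z).trans hz)⟩

theorem bijective_toWaldhausen_one : Function.Bijective ((toWaldhausen hX).app (op ⦋1⦌)) := by
  have hob (y : X _⦋1⦌) : (pathFunctor hX y).wOb 0 1 (Fin.zero_le _) = y := by
    have hid : (simplex ![0, 1] : ⦋1⦌ ⟶ ⦋1⦌) = 𝟙 _ := by decide
    rw [wOb_pathFunctor, hid, map_id_op]
  exact Function.bijective_iff_has_inverse.2 ⟨fun F => AugDoubleFunctor.wOb (D := pathObj X hX) F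
    0 1 (Fin.zero_le _), hob, fun F => ext_one (D := pathObj X hX) (hob _)⟩

theorem bijective_toWaldhausen_two : Function.Bijective ((toWaldhausen hX).app (op ⦋2⦌)) := by
  have hhor (y : X _⦋2⦌) : (pathFunctor hX y).wHor 0 1 2 (Fin.zero_le _) (by decide) = y := by
    have hid : (simplex ![0, 1, 2] : ⦋2⦌ ⟶ ⦋2⦌) = 𝟙 _ := by decide
    rw [wHor_pathFunctor, hid, map_id_op]
  exact Function.bijective_iff_has_inverse.2 ⟨fun F => AugDoubleFunctor.wHor (D := pathObj X hX) F
    0 1 2 (Fin.zero_le _) (by decide), hhor, fun F => ext_two (D := pathObj X hX) (hhor _)⟩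

theorem bijective_toWaldhausen (n : ℕ) :
    Function.Bijective ((toWaldhausen hX).app (op ⦋n⦌)) := by
  match n with
  | 0 => exact bijective_toWaldhausen_zero hX
  | 1 => exact bijective_toWaldhausen_one hX
  | 2 => exact bijective_toWaldhausen_two hX
  | n + 3 =>
    exact hX.twoSegal.bijective_app (isUnitalTwoSegal_waldhausen _).twoSegal _
      (bijective_toWaldhausen_one hX).1 (bijective_toWaldhausen_two hX) (Nat.le_add_left 3 n)

theorem isIso_toWaldhausen : IsIso (toWaldhausen hX) := by
  have happ (a) : IsIso ((toWaldhausen hX).app a) :=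
    (isIso_iff_bijective _).2 (bijective_toWaldhausen hX a.unop.len)
  exact NatIso.isIso_of_isIso_app _

end PathUnit

/-- The natural isomorphism `ι ≅ S_• ∘ 𝒫`. -/
noncomputable def pathUnitIso :
    unitalTwoSegal.{u}.ι ≅ pathConstruction.{u} ⋙ waldhausenConstruction.{u} :=
  NatIso.ofComponents
    (fun X => @asIso _ _ _ _ (toWaldhausen X.property) (isIso_toWaldhausen X.property))
    fun {X Y} φ => by
    ext a y
    refine ext_wHor_zero (F := pathFunctor Y.property (φ.hom.app a y)) fun j l hj hl => ?_
    exact (NatTrans.naturality_apply φ.hom (simplex ![0, j, l]).op y).symm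

/-- The natural isomorphism `N^a ∘ 𝒫 ≅ p^* ∘ ι`, obtained from `ι ≅ S_• ∘ 𝒫` because
`N^a` is `p^* ∘ S_•` by definition. -/
noncomputable def pathNerveIso :
    pathConstruction.{u} ⋙ augNerve.{u} ≅ unitalTwoSegal.{u}.ι ⋙ pUpper.{u} :=
  (Functor.isoWhiskerRight pathUnitIso.{u} pUpper.{u}).symm

/-! ### Right Kan extension along the ordinal sum -/

theorem exists_ordinalSum_map_eq {q r q' r' : ℕ} (f : ⦋q + 1 + r⦌ ⟶ ⦋q' + 1 + r'⦌)
    (hf : ∀ i, (f i).val ≤ q' ↔ i.val ≤ q) :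
    ∃ φ : ((⦋q⦌, ⦋r⦌) : SimplexCategory × SimplexCategory) ⟶ (⦋q'⦌, ⦋r'⦌),
      ordinalSum.map φ = f := by
  have hmono {i j : Fin (q + 1 + r + 1)} (h : i ≤ j) : (f i).val ≤ (f j).val :=
    f.toOrderHom.monotone h
  have hlt (i : Fin (q + 1 + r + 1)) : (f i).val < q' + 1 + r' + 1 := (f i).isLt
  let f₁ : ⦋q⦌ ⟶ ⦋q'⦌ := SimplexCategory.mkHom
    { toFun i := ⟨(f (⟨i, by omega⟩ : Fin (q + 1 + r + 1))).val,
        Nat.lt_succ_of_le ((hf _).2 (Nat.le_of_lt_succ i.isLt))⟩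
      monotone' _ _ hij := hmono hij }
  let f₂ : ⦋r⦌ ⟶ ⦋r'⦌ := SimplexCategory.mkHom
    { toFun i := ⟨(f (⟨q + 1 + i, by omega⟩ : Fin (q + 1 + r + 1))).val - (q' + 1), by
        have := hlt ⟨q + 1 + i, by omega⟩
        omega⟩
      monotone' _ _ hij := Nat.sub_le_sub_right (hmono (Nat.add_le_add_left hij _)) _ }
  refine ⟨(f₁, f₂), simplexHom_ext _ _ fun (i : Fin (q + 1 + r + 1)) => ?_⟩
  by_cases hi : i.val < q + 1
  · exact congrArg Fin.val (dif_pos hi)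
  · have hadd : (⟨q + 1 + (i.val - (q + 1)), by omega⟩ : Fin (q + 1 + r + 1)) = i :=
      Fin.ext (Nat.add_sub_of_le (not_lt.1 hi))
    have hfi : q' + 1 ≤ (f i).val := not_le.1 (mt (hf i).1 (by omega))
    refine (congrArg Fin.val (dif_neg hi)).trans ?_
    change q' + 1 + ((f ⟨q + 1 + (i.val - (q + 1)), _⟩).val - (q' + 1)) = _
    rw [hadd]
    exact Nat.add_sub_of_le hfi

section Extension

variable {G X : SSet.{u}} (α : ordinalSumExt.op ⋙ G ⟶ ordinalSumExt.op ⋙ X)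

/-- The component of `α` at `(q, r)`, in degree `n = q + 1 + r`. -/
def sumApp (q r : ℕ) {n : ℕ} (h : q + 1 + r = n) : G _⦋n⦌ → X _⦋n⦌ :=
  h ▸ α.app (op (WithTerminal.of (⦋q⦌, ⦋r⦌)))

theorem sumApp_map {q r q' r' m n : ℕ} (h : q + 1 + r = m) (h' : q' + 1 + r' = n)
    (f : ⦋m⦌ ⟶ ⦋n⦌) (hf : ∀ i, (f i).val ≤ q' ↔ i.val ≤ q) (g : G _⦋n⦌) :
    sumApp α q r h (G.map f.op g) = X.map f.op (sumApp α q' r' h' g) := by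
  subst h h'
  obtain ⟨φ, rfl⟩ := exists_ordinalSum_map_eq f hf
  exact NatTrans.naturality_apply α (WithTerminal.incl.map φ).op g

theorem sumApp_map_const {q r m : ℕ} (h : q + 1 + r = m) (f : ⦋m⦌ ⟶ ⦋0⦌) (g : G _⦋0⦌) :
    sumApp α q r h (G.map f.op g) = X.map f.op (α.app (op WithTerminal.star) g) := by
  subst h
  obtain rfl : ordinalSumExt.map (WithTerminal.starTerminal.from (.of (⦋q⦌, ⦋r⦌))) = f :=
    SimplexCategory.isTerminalZero.hom_ext _ _
  exact NatTrans.naturality_apply α (WithTerminal.starTerminal.from _).op g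

variable {m n : ℕ}

/-- The component of `α` at the cut of `[n + 1]` into `{0, …, k}` and `{k + 1, …, n + 1}`. -/
def cutApp (k : Fin (n + 1)) : G _⦋n + 1⦌ → X _⦋n + 1⦌ := sumApp α k (n - k) (by omega)

theorem cutApp_map (k : Fin (m + 1)) (k' : Fin (n + 1)) (f : ⦋m + 1⦌ ⟶ ⦋n + 1⦌)
    (hf : ∀ i, (f i).val ≤ k' ↔ i.val ≤ k) (g : G _⦋n + 1⦌) :
    cutApp α k (G.map f.op g) = X.map f.op (cutApp α k' g) :=
  sumApp_map α _ _ f hf g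

theorem exists_σ_eq_cutApp_σ (hX : IsUnitalTwoSegal X) (i : Fin (n + 2)) (g : G _⦋n + 1⦌) :
    ∃ w, X.σ i w = cutApp α i (G.σ i g) := by
  let v : ⦋0⦌ ⟶ ⦋n + 1⦌ := SimplexCategory.const _ _ i
  refine eq_of_degenerate_edge hX i _ (α.app (op WithTerminal.star) (G.map v.op g)) ?_
  calc X.σ 0 (α.app (op WithTerminal.star) (G.map v.op g))
    _ = cutApp α 0 (G.σ 0 (G.map v.op g)) := (sumApp_map_const α _ _ _).symm
    _ = cutApp α 0 (G.map (SimplexCategory.mkOfSucc i).op (G.σ i g)) :=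
      congrArg _ (map_map_eq G (mkOfSucc_comp_σ i).symm g)
    _ = X.map (SimplexCategory.mkOfSucc i).op (cutApp α i (G.σ i g)) := by
      refine cutApp_map α 0 i _ (fun j => ?_) _
      rw [mkOfSucc_val]
      simp

theorem cutApp_σ (hX : IsUnitalTwoSegal X) {i : Fin (n + 2)} {j : Fin (n + 3)} {k : Fin (n + 1)}
    (hj : SimplexCategory.δ j ≫ SimplexCategory.σ i = 𝟙 _)
    (hk : ∀ l, (SimplexCategory.δ j l).val ≤ i ↔ l.val ≤ k) (g : G _⦋n + 1⦌) :
    cutApp α i (G.σ i g) = X.σ i (cutApp α k g) := by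
  obtain ⟨w, hw⟩ := exists_σ_eq_cutApp_σ α hX i g
  have hwk : w = cutApp α k g :=
    calc w
      _ = X.δ j (cutApp α i (G.σ i g)) := by rw [← hw, deg_face X hj]
      _ = cutApp α k (G.δ j (G.σ i g)) := (cutApp_map α k i _ hk _).symm
      _ = cutApp α k g := by rw [deg_face G hj]
  rw [← hw, hwk]

theorem cutApp_σ_succ (hX : IsUnitalTwoSegal X) (k : Fin (n + 1)) (g : G _⦋n + 1⦌) :
    cutApp α k.succ (G.σ k.succ g) = X.σ k.succ (cutApp α k g) := by
  refine cutApp_σ α hX SimplexCategory.δ_comp_σ_self (fun l => ?_) g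
  rw [δ_val, Fin.val_castSucc, Fin.val_succ]
  split_ifs <;> omega

theorem cutApp_σ_castSucc (hX : IsUnitalTwoSegal X) (k : Fin (n + 1)) (g : G _⦋n + 1⦌) :
    cutApp α k.castSucc (G.σ k.castSucc g) = X.σ k.castSucc (cutApp α k g) := by
  refine cutApp_σ α hX SimplexCategory.δ_comp_σ_succ (fun l => ?_) g
  rw [δ_val, Fin.val_castSucc, Fin.val_succ, Fin.val_castSucc]
  split_ifs <;> omega

/- Let `σ g` be the degeneracy of `g` at the vertex `k + 1`. The cut of `σ g` between the two equal
vertices restricts, along the two sections of `σ`, to the cuts of `g` after and before `k + 1`. -/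
theorem cutApp_eq_cutApp_zero (hX : IsUnitalTwoSegal X) (k : Fin (n + 1)) :
    cutApp α k = cutApp α 0 := by
  induction k using Fin.induction with
  | zero => rfl
  | succ k ih =>
    refine (funext fun g => ?_).trans ih
    have hσ : X.σ k.succ.castSucc (cutApp α k.succ g) =
        X.σ k.castSucc.succ (cutApp α k.castSucc g) :=
      (cutApp_σ_castSucc α hX k.succ g).symm.trans (cutApp_σ_succ α hX k.castSucc g)
    rw [← deg_face X SimplexCategory.δ_comp_σ_self (cutApp α k.succ g), hσ,
      Fin.succ_castSucc, deg_face X SimplexCategory.δ_comp_σ_self]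

theorem exists_comp_σ_eq (f : ⦋m + 1⦌ ⟶ ⦋n + 1⦌) (k : Fin (m + 1)) :
    ∃ (c : Fin (n + 2)) (f' : ⦋m + 1⦌ ⟶ ⦋n + 2⦌), f' ≫ SimplexCategory.σ c = f ∧
      ∀ i, (f' i).val ≤ c ↔ i.val ≤ k := by
  have hmono {i j : Fin (m + 2)} (h : i ≤ j) : (f i).val ≤ (f j).val := f.toOrderHom.monotone h
  let c : Fin (n + 2) := f k.castSucc
  have hle (i : Fin (m + 2)) (hi : i.val ≤ k) : (f i).val ≤ c := hmono (Fin.le_def.2 hi)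
  have hge (i : Fin (m + 2)) (hi : ¬ i.val ≤ k) : c.val ≤ (f i).val :=
    hmono (Fin.le_def.2 (Nat.le_of_not_le hi))
  let f' : ⦋m + 1⦌ ⟶ ⦋n + 2⦌ := SimplexCategory.mkHom
    { toFun i := if i.val ≤ k then Fin.castSucc (f i) else Fin.succ (f i)
      monotone' i j hij := by
        have hfij := hmono hij
        rw [Fin.le_def] at hij ⊢
        dsimp only
        split_ifs <;> simp only [Fin.val_castSucc, Fin.val_succ] <;> omega }
  have hf' (i : Fin (m + 2)) : (f' i).val = if i.val ≤ k then (f i).val else (f i).val + 1 :=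
    apply_ite Fin.val _ _ _
  refine ⟨c, f', simplexHom_ext _ _ fun i => ?_, fun i => ?_⟩
  · rw [comp_val, σ_val, hf']
    have := hle i
    have := hge i
    split_ifs <;> omega
  · rw [hf']
    have := hle i
    have := hge i
    split_ifs <;> omega

theorem cutApp_zero_map (hX : IsUnitalTwoSegal X) (f : ⦋m + 1⦌ ⟶ ⦋n + 1⦌) (g : G _⦋n + 1⦌) :
    cutApp α 0 (G.map f.op g) = X.map f.op (cutApp α 0 g) := by
  obtain ⟨c, f', rfl, hf'⟩ := exists_comp_σ_eq f 0
  have hσ : cutApp α c (G.σ c g) = X.σ c (cutApp α 0 g) := by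
    induction c using Fin.cases with
    | zero => exact cutApp_σ_castSucc α hX 0 g
    | succ k => rw [cutApp_σ_succ α hX, cutApp_eq_cutApp_zero α hX]
  rw [← map_map_op, ← map_map_op, cutApp_map α 0 c f' hf']
  exact congrArg _ hσ

/-- The components of the extension of `α` to a map of simplicial sets. -/
def extendApp (n : ℕ) : G _⦋n⦌ → X _⦋n⦌ :=
  match n with
  | 0 => α.app (op WithTerminal.star)
  | _ + 1 => cutApp α 0

theorem extendApp_eq_sumApp (hX : IsUnitalTwoSegal X) {q r : ℕ} (h : q + 1 + r = n) :
    extendApp α n = sumApp α q r h := by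
  obtain _ | n := n
  · omega
  · obtain rfl : r = n - q := by omega
    exact (cutApp_eq_cutApp_zero α hX (⟨q, by omega⟩ : Fin (n + 1))).symm

theorem extendApp_succ_map (hX : IsUnitalTwoSegal X) (f : ⦋m + 1⦌ ⟶ ⦋n⦌) (g : G _⦋n⦌) :
    extendApp α (m + 1) (G.map f.op g) = X.map f.op (extendApp α n g) := by
  obtain _ | n := n
  · exact sumApp_map_const α _ f g
  · exact cutApp_zero_map α hX f g

theorem extendApp_map (hX : IsUnitalTwoSegal X) (f : ⦋m⦌ ⟶ ⦋n⦌) (g : G _⦋n⦌) :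
    extendApp α m (G.map f.op g) = X.map f.op (extendApp α n g) := by
  obtain _ | m := m
  · have hσ : X.σ 0 (extendApp α 0 (G.map f.op g)) = X.σ 0 (X.map f.op (extendApp α n g)) :=
      calc X.σ 0 (extendApp α 0 (G.map f.op g))
        _ = extendApp α 1 (G.σ 0 (G.map f.op g)) := (extendApp_succ_map α hX _ _).symm
        _ = extendApp α 1 (G.map (SimplexCategory.σ 0 ≫ f).op g) :=
          congrArg _ (map_map_op G _ f g)
        _ = X.map (SimplexCategory.σ 0 ≫ f).op (extendApp α n g) := extendApp_succ_map α hX _ _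
        _ = X.σ 0 (X.map f.op (extendApp α n g)) := (map_map_op X _ f _).symm
    rw [← deg_face X SimplexCategory.δ_comp_σ_self (extendApp α 0 _), hσ,
      deg_face X SimplexCategory.δ_comp_σ_self]
  · exact extendApp_succ_map α hX f g

/-- The extension of `α` to a map of simplicial sets. -/
def extend (hX : IsUnitalTwoSegal X) : G ⟶ X where
  app a := ↾(extendApp α a.unop.len)
  naturality a b f := by
    ext g
    exact extendApp_map α hX (m := b.unop.len) (n := a.unop.len) f.unop g

theorem whiskerLeft_extend (hX : IsUnitalTwoSegal X) :
    Functor.whiskerLeft ordinalSumExt.op (extend α hX) = α := by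
  ext ⟨a⟩ g
  cases a with
  | star => rfl
  | of x => exact congrFun (extendApp_eq_sumApp α hX (q := x.1.len) (r := x.2.len) rfl) g

end Extension

theorem whiskerLeft_ordinalSumExt_injective (G X : SSet.{u}) :
    Function.Injective fun β : G ⟶ X => Functor.whiskerLeft ordinalSumExt.op β := by
  intro β β' h
  ext ⟨a⟩ g
  induction a using SimplexCategory.rec with
  | _ n =>
    have happ (s : SigmaCat) := ConcreteCategory.congr_hom (NatTrans.congr_app h (op s))
    obtain _ | n := n
    · exact happ WithTerminal.star g
    · exact happ (WithTerminal.of (⦋n⦌, ⦋0⦌)) g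

theorem isRightKanExtension {X : SSet.{u}} (hX : IsUnitalTwoSegal X) :
    X.IsRightKanExtension (𝟙 (ordinalSumExt.op ⋙ X)) where
  nonempty_isUniversal := ⟨Limits.IsTerminal.ofUniqueHom
    (fun E => CostructuredArrow.homMk (extend E.hom hX)
      ((Category.comp_id _).trans (whiskerLeft_extend E.hom hX)))
    fun E f => CostructuredArrow.hom_ext _ _ <| whiskerLeft_ordinalSumExt_injective _ _ <|
      ((Category.comp_id _).symm.trans (CostructuredArrow.w f)).trans
        (whiskerLeft_extend E.hom hX).symm⟩

theorem isIso_unit_app {X : SSet.{u}} (hX : IsUnitalTwoSegal X) :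
    IsIso (pAdjunction.{u}.unit.app X) :=
  (ordinalSumExt.op.isIso_ranAdjunction_unit_app_iff X).2 (isRightKanExtension hX)

/-- The natural isomorphism `S_• ≅ p_* ∘ N^a`: as `N^a` is `p^* ∘ S_•` by definition, it is given by
the unit of the adjunction `p^* ⊣ p_*`. -/
noncomputable def waldhausenIso : waldhausenConstruction.{u} ≅ augNerve.{u} ⋙ pLower.{u} :=
  NatIso.ofComponents
    (fun D => @asIso _ _ _ _ (pAdjunction.{u}.unit.app (waldhausenConstruction.obj D))
      (isIso_unit_app (isUnitalTwoSegal_waldhausen D)))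
    fun f => pAdjunction.{u}.unit.naturality (waldhausenConstruction.map f)

end Waldhausen

theorem proposition3p5 :
    ∃ hS : ∀ D : Waldhausen.AugStDoubleCat.{u},
        Waldhausen.IsUnitalTwoSegal (Waldhausen.waldhausenConstruction.obj D),
      Nonempty
        (Waldhausen.pathConstruction.{u} ⋙ Waldhausen.augNerve.{u} ≅
          Waldhausen.unitalTwoSegal.{u}.ι ⋙ Waldhausen.pUpper.{u}) ∧
      Nonempty
        (Waldhausen.unitalTwoSegal.{u}.lift Waldhausen.waldhausenConstruction.{u} hS ⋙
            Waldhausen.unitalTwoSegal.{u}.ι ≅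
          Waldhausen.augNerve.{u} ⋙ Waldhausen.pLower.{u}) :=
  ⟨Waldhausen.isUnitalTwoSegal_waldhausen, ⟨Waldhausen.pathNerveIso⟩,
    ⟨Waldhausen.unitalTwoSegal.liftCompιIso _ _ ≪≫ Waldhausen.waldhausenIso⟩⟩
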